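/- Let $v_{40},v_{22},v_{04},v_{60},v_{42},v_{24},v_{06}$ be real and put $A=\frac38(v_{40}+v_{04})$, $B=\frac34(v_{40}-v_{04})$, $C=\frac18v_{22}$. For $\mathcal E>0$ and $\delta\in\mathbb R$ consider the one-degree-of-freedom system with the Hamiltonian $$\mathcal K(J,\psi;\mathcal E,\delta)=\mathcal E+\mathcal A_1+\mathcal B_1\cos2\psi+\mathcal A_2+\mathcal B_2\cos2\psi,\qquad 0\le J\le\mathcal E,$$ $\mathcal A_1=(2A-B)\mathcal E^2+(-4A+2B+8C)\mathcal EJ+\delta J+4(A-2C)J^2$, $\ \mathcal B_1=4CJ(\mathcal E-J)$, $\mathcal A_2=\frac19(68AB-68A^2-17B^2+\frac{45}2v_{06})\mathcal E^3-8C\delta\mathcal EJ+(\frac{68}3A^2-\frac{68}3AB+\frac{17}3B^2-32AC+16BC-36C^2+\frac32v_{24}-\frac{15}2v_{06})\mathcal E^2J+(\frac{68}3AB-\frac{68}3A^2-\frac{17}3B^2+32AC-48BC+36C^2+\frac32v_{42}-3v_{24}+\frac{15}2v_{06})\mathcal EJ^2+2(4C-2A-B)\delta J^2+(32BC+\frac52v_{60}-\frac{136}9AB-\frac32v_{42}+\frac32v_{24}-\frac52v_{06})J^3$,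 $\mathcal B_2=-4C\delta\mathcal EJ+(-\frac{40}3AC+\frac{20}3BC-32C^2+v_{24})\mathcal E^2J+(\frac{40}3AC-20BC+32C^2+v_{42}-2v_{24})\mathcal EJ^2+4C\delta J^2+(\frac{40}3BC-v_{42}+v_{24})J^3$. Its phase space is a sphere with canonical charts $\sqrt{2J}(\cos\psi,\sin\psi)$ for $J<\mathcal E$ and, with the opposite orientation, $\sqrt{2(\mathcal E-J)}(\cos\psi,\sin\psi)$ for $J>0$. The fixed points $J=0$ and $J=\mathcal E$ are the normal modes 1 and 2. Fixed points with $0<J<\mathcal E$ are called inclined if $\psi\in\{0,\pi\}$ and loops if $\psi=\pm\pi/2$. Stability is Lyapunov stability. A bifurcation $(1K)$ (pitchfork) at a given energy means that, as $\mathcal E$ increases through it, a symmetric pair of fixed points of the family $K$ is born from mode 1; a bifurcation $(2K)$ (anti-pitchfork) means that such a pair is absorbed by mode 2. In both cases the mode changes its stability there, and where the pair does not exist the mode has the stability type of the pair. The letters $I,i$ denote stable, unstable inclined points, and $L,\ell$ stable, unstable loops. Put, for $K=I$ with $k=3$ and for $K=L$ with $k=1$, $$\mathcal E_{1K}=\frac{\delta}{2(2A-B-2kC)}+\frac{N_{1K}\,\delta^2}{48(2A-B-2kC)^3},\qquad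 \mathcal E_{2K}=-\frac{\delta}{2(2A+B-2kC)}-\frac{N_{2K}\,\delta^2}{48(2A+B-2kC)^3},$$ $N_{1I}=136A^2+34B^2+280BC+456C^2-8A(17B+70C)+15v_{24}-45v_{06}$, $N_{1L}=136A^2+34B^2+104BC+72C^2-8A(17B+26C)+3v_{24}-45v_{06}$, $N_{2I}=56A^2+14B^2+8A(7B-74C)-296BC+1272C^2+45v_{60}-15v_{42}$, $N_{2L}=56A^2+14B^2+8A(7B-22C)-88BC+120C^2+45v_{60}-3v_{42}$. Suppose $C\ne0$, $A-3C<0$, $A-C<0$. There are $\mathcal E_0,\delta_0>0$ and $M$, depending only on the coefficients, and functions $e_{1I},e_{1L},e_{2I},e_{2L}$ of $\delta$ such that the following holds. (a) Consider the conditions $B>2(A-3C)$, $B>2(A-C)$, $B>2(C-A)$, $B>2(3C-A)$, belonging to $1I$, $1L$, $2L$, $2I$ respectively. Under the condition belonging to $mK$ we have $|e_{mK}(\delta)-\mathcal E_{mK}|\le M|\delta|^3$ for $-\delta_0\le\delta\le0$, and $0<e_{mK}(\delta)<\mathcal E_0$ for $-\delta_0\le\delta<0$. (b) Let $C>0$ and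 $-\delta_0\le\delta<0$. Each of the bifurcations $(1I)$, $(1\ell)$, $(2\ell)$, $(2I)$ whose condition on $B$ holds occurs, at the energies $e_{1I},e_{1L},e_{2L},e_{2I}$ respectively, and those that occur do so in this order, at strictly increasing energies. (c) Let $C<0$ and $-\delta_0\le\delta<0$. The same holds for the sequence $(1L)$, $(1i)$, $(2i)$, $(2L)$, at the energies $e_{1L},e_{1I},e_{2I},e_{2L}$. (d) If $B$ is different from the bound in the condition belonging to $mK$, then for $-\delta_0\le\delta<0$ a bifurcation of the family $K$ from (or to) the mode $m$ at an energy in $(0,\mathcal E_0)$ occurs only if that condition holds, and only at $e_{mK}(\delta)$. If the condition fails (equality included), then for every $\Lambda$ and all sufficiently small $\delta<0$ there is no such bifurcation at an energy in $(0,\Lambda|\delta|]$. (e) For $-\delta_0\le\delta\le0$ and $0<\mathcal E<\mathcal E_0$ all fixed points with $0<J<\mathcal E$ are inclined or loops. If $B$ differs from the two bounds belonging to a family $K$, then that family consists of exactly one symmetric pair when the condition of $1K$ holds, $\mathcal E>e_{1K}(\delta)$, and either the condition of $2K$ fails or $\mathcal E<e_{2K}(\delta)$; otherwise it is empty. The inclined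 pair is stable and the loop pair unstable for $C>0$, and conversely for $C<0$. -/

import Mathlib

open Set

noncomputable section

namespace Resonance22

/-- Physical coefficients: `vjk` multiplies `x₁ ^ j * x₂ ^ k` in the quartic and sextic parts
of the natural Hamiltonian (reflection-symmetric in both variables). -/
structure Coeffs where
  v40 : ℝ
  v22 : ℝ
  v04 : ℝ
  v60 : ℝ
  v42 : ℝ
  v24 : ℝ
  v06 : ℝ

namespace Coeffs

def A (c : Coeffs) : ℝ := 3 / 8 * (c.v40 + c.v04)

def B (c : Coeffs) : ℝ := 3 / 4 * (c.v40 - c.v04)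

def C (c : Coeffs) : ℝ := 1 / 8 * c.v22

end Coeffs

/-- The terms of the normal form of degree two in the actions (and detuning), phase-independent
part. -/
def termA1 (c : Coeffs) (δ E J : ℝ) : ℝ :=
  (2 * c.A - c.B) * E ^ 2 + (-4 * c.A + 2 * c.B + 8 * c.C) * E * J + δ * J
    + 4 * (c.A - 2 * c.C) * J ^ 2

/-- Coefficient of `cos 2ψ` at first order. -/
def termB1 (c : Coeffs) (E J : ℝ) : ℝ := 4 * c.C * J * (E - J)

/-- Phase-independent part at second order. -/
def termA2 (c : Coeffs) (δ E J : ℝ) : ℝ :=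
  1 / 9 * (68 * c.A * c.B - 68 * c.A ^ 2 - 17 * c.B ^ 2 + 45 / 2 * c.v06) * E ^ 3
    - 8 * c.C * δ * E * J
    + (68 / 3 * c.A ^ 2 - 68 / 3 * c.A * c.B + 17 / 3 * c.B ^ 2 - 32 * c.A * c.C
        + 16 * c.B * c.C - 36 * c.C ^ 2 + 3 / 2 * c.v24 - 15 / 2 * c.v06) * E ^ 2 * J
    + (68 / 3 * c.A * c.B - 68 / 3 * c.A ^ 2 - 17 / 3 * c.B ^ 2 + 32 * c.A * c.C
        - 48 * c.B * c.C + 36 * c.C ^ 2 + 3 / 2 * c.v42 - 3 * c.v24 + 15 / 2 * c.v06) * E * J ^ 2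
    + 2 * (4 * c.C - 2 * c.A - c.B) * δ * J ^ 2
    + (32 * c.B * c.C + 5 / 2 * c.v60 - 136 / 9 * c.A * c.B - 3 / 2 * c.v42 + 3 / 2 * c.v24
        - 5 / 2 * c.v06) * J ^ 3

/-- Coefficient of `cos 2ψ` at second order. -/
def termB2 (c : Coeffs) (δ E J : ℝ) : ℝ :=
  -4 * c.C * δ * E * J
    + (-40 / 3 * c.A * c.C + 20 / 3 * c.B * c.C - 32 * c.C ^ 2 + c.v24) * E ^ 2 * J
    + (40 / 3 * c.A * c.C - 20 * c.B * c.C + 32 * c.C ^ 2 + c.v42 - 2 * c.v24) * E * J ^ 2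
    + 4 * c.C * δ * J ^ 2
    + (40 / 3 * c.B * c.C - c.v42 + c.v24) * J ^ 3

/-- The one-degree-of-freedom Hamiltonian, with `J = J₁ ∈ [0, E]`, `J₂ = E - J`
and `ψ = φ₁ - φ₂`. -/
def reducedK (c : Coeffs) (δ E J ψ : ℝ) : ℝ :=
  E + (termA1 c δ E J + termB1 c E J * Real.cos (2 * ψ))
    + (termA2 c δ E J + termB2 c δ E J * Real.cos (2 * ψ))

/-- The two normal modes: `one` is the point `J = 0` of the reduced phase space (where
`J₁ = 0`), `two` is the point `J = E` (where `J₂ = 0`). -/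
inductive Mode
  | one
  | two

/-- The families of periodic orbits in general position: inclined (`ψ = 0, π`) and loop
(`ψ = ± π / 2`). -/
inductive Family
  | inclined
  | loop

inductive Stability
  | stable
  | unstable

/-- Direction of a bifurcation for increasing `E`: the pair of fixed points is born, or dies. -/
inductive Direction
  | appears
  | disappears

/-- The angle of a point of the plane. -/
def angle (z : ℝ × ℝ) : ℝ := Complex.arg ⟨z.1, z.2⟩

/-- The planar Hamiltonians. In the first chart `x = √(2J) cos ψ`, `y = √(2J) sin ψ`, in the
second `x' = √(2(E - J)) cos ψ`, `y' = √(2(E - J)) sin ψ`. The reduced phase space (a sphere)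
is covered by the discs of radius `√(2E)` in the two charts; the origin of each of them is the
normal mode of the same name. -/
def planarK (c : Coeffs) (δ E : ℝ) : Mode → ℝ × ℝ → ℝ
  | .one, z => reducedK c δ E ((z.1 ^ 2 + z.2 ^ 2) / 2) (angle z)
  | .two, z => reducedK c δ E (E - (z.1 ^ 2 + z.2 ^ 2) / 2) (angle z)

/-- Hamilton's vector field `ẋ = ∂H/∂y`, `ẏ = -∂H/∂x`. -/
def hamField (H : ℝ × ℝ → ℝ) (z : ℝ × ℝ) : ℝ × ℝ :=
  (deriv (fun y => H (z.1, y)) z.2, -deriv (fun x => H (x, z.2)) z.1)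

/-- The 1DOF system in the two charts. The second chart reverses the symplectic form
`dJ ∧ dψ`, which is accounted for by the sign. -/
def chartField (c : Coeffs) (δ E : ℝ) : Mode → ℝ × ℝ → ℝ × ℝ
  | .one => hamField (planarK c δ E .one)
  | .two => hamField (fun z => -planarK c δ E .two z)

/-- Lyapunov stability of the point `p` for the autonomous system `ż = X z`. -/
def LyapunovStable (X : ℝ × ℝ → ℝ × ℝ) (p : ℝ × ℝ) : Prop :=
  ∀ ε > 0, ∃ η > 0, ∀ (T : ℝ) (γ : ℝ → ℝ × ℝ),
    (∀ t ∈ Icc 0 T, HasDerivWithinAt γ (X (γ t)) (Icc 0 T) t) →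
    dist (γ 0) p < η → ∀ t ∈ Icc 0 T, dist (γ t) p < ε

/-- `p` is stable, or unstable, according to `σ`. -/
def HasStability (X : ℝ × ℝ → ℝ × ℝ) (p : ℝ × ℝ) : Stability → Prop
  | .stable => LyapunovStable X p
  | .unstable => ¬ LyapunovStable X p

def Stability.opposite : Stability → Stability
  | .stable => .unstable
  | .unstable => .stable

/-- The normal mode has stability `σ` as a fixed point of the 1DOF system. -/
def ModeHasStability (c : Coeffs) (δ E : ℝ) (m : Mode) (σ : Stability) : Prop :=
  HasStability (chartField c δ E m) 0 σ

/-- The fixed points of the 1DOF system in general position (`0 < J < E`), in the first chart. -/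
def fixedPoints (c : Coeffs) (δ E : ℝ) : Set (ℝ × ℝ) :=
  {z | 0 < z.1 ^ 2 + z.2 ^ 2 ∧ z.1 ^ 2 + z.2 ^ 2 < 2 * E ∧ chartField c δ E .one z = 0}

/-- The points of the first chart on which the phase has the value(s) of the family. -/
def Family.axis : Family → Set (ℝ × ℝ)
  | .inclined => {z | z.2 = 0}
  | .loop => {z | z.1 = 0}

def familyPoints (c : Coeffs) (δ E : ℝ) (F : Family) : Set (ℝ × ℝ) :=
  fixedPoints c δ E ∩ F.axis

/-- A set of points of the first chart is a symmetric pair of points of stability `σ`. -/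
def IsPair (c : Coeffs) (δ E : ℝ) (σ : Stability) (S : Set (ℝ × ℝ)) : Prop :=
  (∃ z : ℝ × ℝ, z ≠ 0 ∧ S = {z, -z}) ∧ ∀ z ∈ S, HasStability (chartField c δ E .one) z σ

/-- The action that vanishes on the normal mode (`J` or `E - J`), at a point of the
first chart. -/
def modeDist (E : ℝ) : Mode → ℝ × ℝ → ℝ
  | .one, z => (z.1 ^ 2 + z.2 ^ 2) / 2
  | .two, z => E - (z.1 ^ 2 + z.2 ^ 2) / 2

/-- Fixed points of a family in a neighbourhood of a normal mode. -/
def nearPoints (c : Coeffs) (δ E : ℝ) (m : Mode) (F : Family) (ρ : ℝ) : Set (ℝ × ℝ) :=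
  {z | z ∈ familyPoints c δ E F ∧ modeDist E m z < ρ}

/-- The energies near `Es` at which the pair exists. -/
def pairSide (Es r : ℝ) : Direction → Set ℝ
  | .appears => Ioo Es (Es + r)
  | .disappears => Ioo (Es - r) Es

/-- The energies near `Es` at which the pair does not exist. -/
def emptySide (Es r : ℝ) : Direction → Set ℝ
  | .appears => Ioo (Es - r) Es
  | .disappears => Ioo Es (Es + r)

/-- At the energy `Es > 0` a pair of fixed points of the family `F` and of stability `σ`
is born from the normal mode `m` (pitchfork bifurcation, `appears`) or is absorbed by it
(anti-pitchfork, `disappears`), as the energy increases; the normal mode changes its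
stability there, and where there is no pair it has the stability `σ`. -/
def Pitchfork (c : Coeffs) (δ Es : ℝ) (m : Mode) (F : Family) (σ : Stability)
    (d : Direction) : Prop :=
  0 < Es ∧ ∃ r > 0, r ≤ Es ∧ ∃ ρ > 0,
    nearPoints c δ Es m F ρ = ∅ ∧
    (∀ E ∈ emptySide Es r d,
      nearPoints c δ E m F ρ = ∅ ∧ ModeHasStability c δ E m σ) ∧
    (∀ E ∈ pairSide Es r d,
      IsPair c δ E σ (nearPoints c δ E m F ρ) ∧ ModeHasStability c δ E m σ.opposite) ∧
    (∀ ε > 0, ∃ η > 0, ∀ E ∈ pairSide Es r d, |E - Es| < η →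
      ∀ z ∈ nearPoints c δ E m F ρ, modeDist E m z < ε)

/-- The value that `B` has to exceed for the bifurcation of `F` from or to `m`. -/
def threshold (c : Coeffs) : Mode → Family → ℝ
  | .one, .inclined => 2 * (c.A - 3 * c.C)
  | .one, .loop => 2 * (c.A - c.C)
  | .two, .loop => 2 * (c.C - c.A)
  | .two, .inclined => 2 * (3 * c.C - c.A)

/-- The critical energies up to the second order in the detuning. -/
def criticalEnergy (c : Coeffs) (δ : ℝ) : Mode → Family → ℝ
  | .one, .inclined =>
      δ / (2 * (2 * c.A - c.B - 6 * c.C))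
        + (136 * c.A ^ 2 + 34 * c.B ^ 2 + 280 * c.B * c.C + 456 * c.C ^ 2
            - 8 * c.A * (17 * c.B + 70 * c.C) + 15 * c.v24 - 45 * c.v06) * δ ^ 2
          / (48 * (2 * c.A - c.B - 6 * c.C) ^ 3)
  | .one, .loop =>
      δ / (2 * (2 * c.A - c.B - 2 * c.C))
        + (136 * c.A ^ 2 + 34 * c.B ^ 2 + 104 * c.B * c.C + 72 * c.C ^ 2
            - 8 * c.A * (17 * c.B + 26 * c.C) + 3 * c.v24 - 45 * c.v06) * δ ^ 2
          / (48 * (2 * c.A - c.B - 2 * c.C) ^ 3)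
  | .two, .inclined =>
      -(δ / (2 * (2 * c.A + c.B - 6 * c.C)))
        - (56 * c.A ^ 2 + 14 * c.B ^ 2 + 8 * c.A * (7 * c.B - 74 * c.C) - 296 * c.B * c.C
            + 1272 * c.C ^ 2 + 45 * c.v60 - 15 * c.v42) * δ ^ 2
          / (48 * (2 * c.A + c.B - 6 * c.C) ^ 3)
  | .two, .loop =>
      -(δ / (2 * (2 * c.A + c.B - 2 * c.C)))
        - (56 * c.A ^ 2 + 14 * c.B ^ 2 + 8 * c.A * (7 * c.B - 22 * c.C) - 88 * c.B * c.C
            + 120 * c.C ^ 2 + 45 * c.v60 - 3 * c.v42) * δ ^ 2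
          / (48 * (2 * c.A + c.B - 2 * c.C) ^ 3)

/-- For `C > 0` the inclined orbits are stable and the loops unstable; for `C < 0` conversely. -/
def familyStability (c : Coeffs) : Family → Stability
  | .inclined => if 0 < c.C then .stable else .unstable
  | .loop => if 0 < c.C then .unstable else .stable

end Resonance22

end

noncomputable section

namespace Resonance22

/-! Since `J cos 2ψ = (x² - y²)/2`, the Hamiltonian is in each chart a polynomial `P(J) + T(J)(x² -
y²)/2`, even in both variables; in the first chart `T = (E - J) * coupling`. For small `E` and `δ`
the coupling keeps the sign of `C ≠ 0`. Hence every fixed point with `0 < J < E` lies on an axis,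
where it is a zero of `slopeK`, the derivative of the Hamiltonian in `J` along that axis. At `E = δ
= 0` the derivative of `slopeK` in `J` is `8(A - 3C)` for inclined points and `8(A - C)` for loops.
Both are negative, so the slopes decrease in `J`: a family is one symmetric pair if its slope is
positive at mode 1 and negative at mode 2, and is empty otherwise (`SlopeDecreasing.isPair`).

At a mode the slope is `δ + cE E + cδE δ E + cEE E²` with `cE = 2(B - threshold)`. For small `δ < 0`
it increases through a unique small zero in `E` if `cE > 0` and stays negative if `cE < 0`. The
second-order expansion of that zero is `criticalEnergy` (`exists_regime`). At one mode the slopes of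
the two families differ by a multiple of `E * coupling`, and each slope is smaller at mode 2 than at
mode 1; this orders the zeros.

Stability follows from the linearization, which is governed by the product of the two slopes at a
mode and by coupling times curvature at a pair. A nondegenerate extremum is stable because the
Hamiltonian is a first integral (`lyapunovStable_hamField`); at a saddle a product of coordinates
grows along solutions (`not_lyapunovStable_hamField`). `Regime.pitchfork` collects these facts.
Conversely, the points of a pair that shrinks to a mode force the slope to vanish there, so no other
bifurcation is possible. -/

/-! ### Slopes of the Hamiltonian on the two axes -/

/-- The value of `cos 2ψ` on the axis of the family. -/
def Family.sign : Family → ℝ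
  | .inclined => 1
  | .loop => -1

def Family.other : Family → Family
  | .inclined => .loop
  | .loop => .inclined

namespace Coeffs

/-- The coefficient of `E ^ 2 * J` in `termA2`. -/
def cEEJ (c : Coeffs) : ℝ :=
  68 / 3 * c.A ^ 2 - 68 / 3 * c.A * c.B + 17 / 3 * c.B ^ 2 - 32 * c.A * c.C
    + 16 * c.B * c.C - 36 * c.C ^ 2 + 3 / 2 * c.v24 - 15 / 2 * c.v06

/-- The coefficient of `E * J ^ 2` in `termA2`. -/
def cEJJ (c : Coeffs) : ℝ :=
  68 / 3 * c.A * c.B - 68 / 3 * c.A ^ 2 - 17 / 3 * c.B ^ 2 + 32 * c.A * c.C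
    - 48 * c.B * c.C + 36 * c.C ^ 2 + 3 / 2 * c.v42 - 3 * c.v24 + 15 / 2 * c.v06

/-- The coefficient of `J ^ 3` in `termA2`. -/
def cJJJ (c : Coeffs) : ℝ :=
  32 * c.B * c.C + 5 / 2 * c.v60 - 136 / 9 * c.A * c.B - 3 / 2 * c.v42 + 3 / 2 * c.v24
    - 5 / 2 * c.v06

/-- The coefficient of `E` in `coupling`. -/
def dE (c : Coeffs) : ℝ := -40 / 3 * c.A * c.C + 20 / 3 * c.B * c.C - 32 * c.C ^ 2 + c.v24

/-- The coefficient of `J` in `coupling`. -/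
def dJ (c : Coeffs) : ℝ := -(40 / 3 * c.B * c.C - c.v42 + c.v24)

end Coeffs

/-- The coefficient of `J` in the phase-independent part of `reducedK`. -/
def lin (c : Coeffs) (δ E : ℝ) : ℝ :=
  (-4 * c.A + 2 * c.B + 8 * c.C) * E + δ - 8 * c.C * δ * E + c.cEEJ * E ^ 2

/-- The coefficient of `J ^ 2` in the phase-independent part of `reducedK`. -/
def quad (c : Coeffs) (δ E : ℝ) : ℝ :=
  4 * (c.A - 2 * c.C) + c.cEJJ * E + 2 * (4 * c.C - 2 * c.A - c.B) * δ

/-- The coefficient of `cos 2ψ` in `reducedK`, divided by `J * (E - J)`. -/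
def coupling (c : Coeffs) (δ E J : ℝ) : ℝ := 4 * c.C - 4 * c.C * δ + c.dE * E + c.dJ * J

theorem termA_eq (c : Coeffs) (δ E J : ℝ) :
    termA1 c δ E J + termA2 c δ E J = termA1 c δ E 0 + termA2 c δ E 0 + lin c δ E * J
      + quad c δ E * J ^ 2 + c.cJJJ * J ^ 3 := by
  unfold termA1 termA2 lin quad Coeffs.cEEJ Coeffs.cEJJ Coeffs.cJJJ; ring

/-- The coefficient of `cos 2ψ` vanishes at both modes; the remaining factor is affine in `J` and
close to `4C`. -/
theorem termB_eq (c : Coeffs) (δ E J : ℝ) :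
    termB1 c E J + termB2 c δ E J = J * (E - J) * coupling c δ E J := by
  unfold termB1 termB2 coupling Coeffs.dE Coeffs.dJ; ring

/-- The derivative of `J ↦ reducedK c δ E J ψ` on the axis of the family. -/
def slopeK (c : Coeffs) (F : Family) (δ E J : ℝ) : ℝ :=
  lin c δ E + 2 * quad c δ E * J + 3 * c.cJJJ * J ^ 2
    + F.sign * ((E - 2 * J) * coupling c δ E J + J * (E - J) * c.dJ)

/-- The divided difference of `slopeK` in `J`. -/
def curvK (c : Coeffs) (F : Family) (δ E J J' : ℝ) : ℝ :=
  2 * quad c δ E + 3 * c.cJJJ * (J + J')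
    + F.sign * (2 * c.dJ * E - 2 * (4 * c.C - 4 * c.C * δ + c.dE * E) - 3 * c.dJ * (J + J'))

/-- One function serves twice: its sign gives monotonicity of the slope in `J`, and its diagonal is
the second derivative that enters the linearization at a pair. -/
theorem slopeK_sub (c : Coeffs) (F : Family) (δ E J J' : ℝ) :
    slopeK c F δ E J - slopeK c F δ E J' = (J - J') * curvK c F δ E J J' := by
  unfold slopeK curvK coupling; ring

/-- The value of `J` at the normal mode. -/
def Mode.action (E : ℝ) : Mode → ℝ
  | .one => 0
  | .two => E

/-- The coefficient of `E` in `slopeK` at a normal mode. -/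
def cE (c : Coeffs) (m : Mode) (F : Family) : ℝ := 2 * (c.B - threshold c m F)

/-- The coefficient of `δ * E` in `slopeK` at a normal mode. -/
def cδE (c : Coeffs) : Mode → Family → ℝ
  | .one, F => -8 * c.C - 4 * F.sign * c.C
  | .two, F => 8 * c.C - 4 * c.B - 8 * c.A + 4 * F.sign * c.C

/-- The coefficient of `E ^ 2` in `slopeK` at a normal mode. -/
def cEE (c : Coeffs) : Mode → Family → ℝ
  | .one, F => c.cEEJ + F.sign * c.dE
  | .two, F => c.cEEJ + 2 * c.cEJJ + 3 * c.cJJJ - F.sign * (c.dE + c.dJ)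

theorem slopeK_mode (c : Coeffs) (m : Mode) (F : Family) (δ E : ℝ) :
    slopeK c F δ E (m.action E) = δ + cE c m F * E + cδE c m F * δ * E + cEE c m F * E ^ 2 := by
  cases m <;> cases F <;>
  simp only [slopeK, Mode.action, cE, cδE, cEE, lin, quad, coupling, Family.sign, threshold] <;>
  ring

/-- The right side is the formal second-order expansion of the small zero of `δ + αE + κδE + γE²`,
which by `slopeK_mode` is the slope at the mode. -/
theorem criticalEnergy_eq (c : Coeffs) (m : Mode) (F : Family) (h : cE c m F ≠ 0) (δ : ℝ) :
    criticalEnergy c δ m F = -δ / cE c m F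
      + (cδE c m F * cE c m F - cEE c m F) * δ ^ 2 / cE c m F ^ 3 := by
  cases m <;> cases F <;> simp only [cE, threshold, criticalEnergy] at h ⊢
  -- The denominators of `criticalEnergy` are `cE` up to a factor: `-2` for mode one, `2` for mode
  -- two.
  · have h1 : 2 * c.A - c.B - 6 * c.C ≠ 0 := fun h' => h (by linear_combination (-2) * h')
    have h2 : 2 * (c.B - 2 * (c.A - 3 * c.C)) = (-2) * (2 * c.A - c.B - 6 * c.C) := by ring
    rw [h2]; field_simp
    simp only [cδE, cEE, Coeffs.cEEJ, Coeffs.dE, Family.sign]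
    ring
  · have h1 : 2 * c.A - c.B - 2 * c.C ≠ 0 := fun h' => h (by linear_combination (-2) * h')
    have h2 : 2 * (c.B - 2 * (c.A - c.C)) = (-2) * (2 * c.A - c.B - 2 * c.C) := by ring
    rw [h2]; field_simp
    simp only [cδE, cEE, Coeffs.cEEJ, Coeffs.dE, Family.sign]
    ring
  · have h1 : 2 * c.A + c.B - 6 * c.C ≠ 0 := fun h' => h (by linear_combination 2 * h')
    have h2 : 2 * (c.B - 2 * (3 * c.C - c.A)) = 2 * (2 * c.A + c.B - 6 * c.C) := by ring
    rw [h2]; field_simp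
    simp only [cδE, cEE, Coeffs.cEEJ, Coeffs.cEJJ, Coeffs.cJJJ, Coeffs.dE, Coeffs.dJ,
      Family.sign]
    ring
  · have h1 : 2 * c.A + c.B - 2 * c.C ≠ 0 := fun h' => h (by linear_combination 2 * h')
    have h2 : 2 * (c.B - 2 * (c.C - c.A)) = 2 * (2 * c.A + c.B - 2 * c.C) := by ring
    rw [h2]; field_simp
    simp only [cδE, cEE, Coeffs.cEEJ, Coeffs.cEJJ, Coeffs.cJJJ, Coeffs.dE, Coeffs.dJ,
      Family.sign]
    ring

/-! ### Stability of equilibria of planar Hamiltonian systems -/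

open Metric Topology Filter

theorem hamField_eq {H : ℝ × ℝ → ℝ} (hH : Differentiable ℝ H) (z : ℝ × ℝ) :
    hamField H z = (fderiv ℝ H z (0, 1), -fderiv ℝ H z (1, 0)) := by
  have h1 : HasDerivAt (fun y : ℝ => (z.1, y)) (0, 1) z.2 :=
    (hasDerivAt_const _ _).prodMk (hasDerivAt_id _)
  have h2 : HasDerivAt (fun x : ℝ => (x, z.2)) (1, 0) z.1 :=
    (hasDerivAt_id _).prodMk (hasDerivAt_const _ _)
  have e1 := ((hH z).hasFDerivAt.comp_hasDerivAt (f := fun y : ℝ => (z.1, y)) z.2 h1).deriv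
  have e2 := ((hH z).hasFDerivAt.comp_hasDerivAt (f := fun x : ℝ => (x, z.2)) z.1 h2).deriv
  simp only [Function.comp_def] at e1 e2
  simp only [hamField, e1, e2]

theorem fderiv_apply_eq_hamField {H : ℝ × ℝ → ℝ} (hH : Differentiable ℝ H) (z w : ℝ × ℝ) :
    fderiv ℝ H z w = (hamField H z).1 * w.2 - (hamField H z).2 * w.1 := by
  rw [hamField_eq hH]
  have : w = w.1 • ((1 : ℝ), (0 : ℝ)) + w.2 • ((0 : ℝ), (1 : ℝ)) := by ext <;> simp
  conv_lhs => rw [this, map_add, map_smul, map_smul]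
  simp only [smul_eq_mul]; ring

theorem contDiff_hamField {H : ℝ × ℝ → ℝ} (hH : ContDiff ℝ 2 H) : ContDiff ℝ 1 (hamField H) := by
  have h : hamField H = fun z => (fderiv ℝ H z (0, 1), -fderiv ℝ H z (1, 0)) :=
    funext fun z => hamField_eq (hH.differentiable (by norm_num)) z
  have h1 : ContDiff ℝ 1 (fderiv ℝ H) := hH.fderiv_right (by norm_num)
  rw [h]
  exact (h1.clm_apply contDiff_const).prodMk (h1.clm_apply contDiff_const).neg

/-- A continuous first integral with a strict local minimum makes the point Lyapunov stable. -/
theorem lyapunovStable_of_firstIntegral {X : ℝ × ℝ → ℝ × ℝ} {V : ℝ × ℝ → ℝ} {p : ℝ × ℝ}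
    (hV : Differentiable ℝ V) (hX : ∀ z, fderiv ℝ V z (X z) = 0)
    (hp : ∀ᶠ z in 𝓝 p, z ≠ p → V p < V z) : LyapunovStable X p := by
  intro ε hε
  obtain ⟨r, hr, hball⟩ := Metric.eventually_nhds_iff.1 hp
  -- The sphere of radius `ε'` stays inside the neighbourhood where `p` is a strict minimum.
  set ε' := min ε (r / 2) with hε'
  have hε'0 : 0 < ε' := lt_min hε (by linarith)
  obtain ⟨q, hq, hmin⟩ := (isCompact_sphere p ε').exists_isMinOn
    (NormedSpace.sphere_nonempty.2 hε'0.le) hV.continuous.continuousOn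
  have hqp : V p < V q := by
    apply hball
    · rw [mem_sphere.1 hq]; linarith [min_le_right ε (r / 2)]
    · rintro rfl; rw [mem_sphere, dist_self] at hq; linarith
  obtain ⟨η, hη, hηV⟩ := Metric.eventually_nhds_iff.1
    (hV.continuous.continuousAt.eventually_lt continuousAt_const hqp)
  refine ⟨min η ε', lt_min hη hε'0, fun T γ hγ h0 t ht => ?_⟩
  have hconst : ∀ s ∈ Icc 0 T, V (γ s) = V (γ 0) := by
    have hd : ∀ s ∈ Icc 0 T, HasDerivWithinAt (V ∘ γ) 0 (Icc 0 T) s := fun s hs => by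
      simpa [hX] using (hV (γ s)).hasFDerivAt.comp_hasDerivWithinAt s (hγ s hs)
    refine constant_of_derivWithin_zero (fun s hs => (hd s hs).differentiableWithinAt)
      fun s hs => ?_
    exact (hd s (Ico_subset_Icc_self hs)).derivWithin
      (uniqueDiffOn_Icc (hs.1.trans_lt hs.2) s (Ico_subset_Icc_self hs))
  -- A solution that leaves would meet the sphere, where `V ≥ V q`; but `V` is constant along it and
  -- starts below `V q`.
  by_contra hcon
  have hle : ε' ≤ dist (γ t) p := (min_le_left _ _).trans (not_lt.1 hcon)
  have hcont : ContinuousOn (fun s => dist (γ s) p) (Icc 0 t) := fun s hs =>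
    (((hγ s ⟨hs.1, hs.2.trans ht.2⟩).continuousWithinAt).mono
      (Icc_subset_Icc_right ht.2)).dist continuousWithinAt_const
  obtain ⟨s, hs, hse⟩ := intermediate_value_Icc ht.1 hcont
    ⟨(h0.trans_le (min_le_right _ _)).le, hle⟩
  have h1 : V q ≤ V (γ s) := hmin (mem_sphere.2 hse)
  rw [hconst s ⟨hs.1, hs.2.trans ht.2⟩] at h1
  exact absurd (hηV (h0.trans_le (min_le_left _ _))) (not_lt.2 h1)

/-- The nearest point of the closed square of radius `ε` around `p`. -/
def clamp (p : ℝ × ℝ) (ε : ℝ) (z : ℝ × ℝ) : ℝ × ℝ :=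
  (max (p.1 - ε) (min (p.1 + ε) z.1), max (p.2 - ε) (min (p.2 + ε) z.2))

theorem lipschitzWith_clamp (p : ℝ × ℝ) (ε : ℝ) : LipschitzWith 1 (clamp p ε) := by
  have h (a b : ℝ) : LipschitzWith 1 fun x : ℝ => max a (min b x) :=
    (LipschitzWith.id.const_min b).const_max a
  have := ((h (p.1 - ε) (p.1 + ε)).comp LipschitzWith.prod_fst).prodMk
    ((h (p.2 - ε) (p.2 + ε)).comp LipschitzWith.prod_snd)
  simpa [clamp, Function.comp_def, Function.id_def] using! this

theorem clamp_mem (p : ℝ × ℝ) {ε : ℝ} (hε : 0 ≤ ε) (z : ℝ × ℝ) : clamp p ε z ∈ closedBall p ε := by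
  rw [mem_closedBall, Prod.dist_eq, Real.dist_eq, Real.dist_eq, max_le_iff, abs_le, abs_le]
  simp only [clamp]
  refine ⟨⟨?_, ?_⟩, ⟨?_, ?_⟩⟩
  · linarith [le_max_left (p.1 - ε) (min (p.1 + ε) z.1)]
  · linarith [max_le (show p.1 - ε ≤ p.1 + ε by linarith) (min_le_left (p.1 + ε) z.1)]
  · linarith [le_max_left (p.2 - ε) (min (p.2 + ε) z.2)]
  · linarith [max_le (show p.2 - ε ≤ p.2 + ε by linarith) (min_le_left (p.2 + ε) z.2)]

theorem clamp_eq_self {p : ℝ × ℝ} {ε : ℝ} {z : ℝ × ℝ} (hz : z ∈ closedBall p ε) :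
    clamp p ε z = z := by
  rw [mem_closedBall, Prod.dist_eq, Real.dist_eq, Real.dist_eq, max_le_iff, abs_le, abs_le] at hz
  obtain ⟨⟨h1, h2⟩, h3, h4⟩ := hz
  ext
  · simp only [clamp]; rw [min_eq_right (by linarith), max_eq_right (by linarith)]
  · simp only [clamp]; rw [min_eq_right (by linarith), max_eq_right (by linarith)]

/-- A vector field that is Lipschitz on a ball has solutions up to the exit from the ball; the
ones that do not exit within time `T` are defined on `[0, T]`. -/
theorem exists_solution_clamp {X : ℝ × ℝ → ℝ × ℝ} {p : ℝ × ℝ} {ε : ℝ} (hε : 0 ≤ ε) {K : NNReal}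
    (hX : LipschitzOnWith K X (closedBall p ε)) (q : ℝ × ℝ) {T : ℝ} (hT : 0 ≤ T) :
    ∃ γ : ℝ → ℝ × ℝ, γ 0 = q ∧
      ∀ t ∈ Icc 0 T, HasDerivWithinAt γ (X (clamp p ε (γ t))) (Icc 0 T) t := by
  obtain ⟨L, hL⟩ := (isCompact_closedBall p ε).exists_bound_of_continuousOn hX.continuousOn
  -- Composed with `clamp`, the field is Lipschitz and bounded by `L` on the whole plane, so a ball
  -- of radius `L * T` suffices for all of `[0, T]`.
  have hpl : IsPicardLindelof (fun _ z => X (clamp p ε z)) (⟨0, left_mem_Icc.2 hT⟩ : Icc 0 T) q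
      (L.toNNReal * T.toNNReal) 0 L.toNNReal K := by
    refine ⟨fun t _ => ?_, fun x _ => continuousOn_const, fun t _ x _ => ?_, ?_⟩
    · have h := hX.comp (lipschitzWith_clamp p ε).lipschitzOnWith
        (fun z _ => clamp_mem p hε z : MapsTo _ univ _)
      rw [mul_one] at h
      exact h.mono (subset_univ _)
    · exact (hL _ (clamp_mem p hε x)).trans (Real.le_coe_toNNReal L)
    · simp [hT]
  exact hpl.exists_eq_forall_mem_Icc_hasDerivWithinAt₀

/-- A point is unstable if a coordinate product grows near it along solutions. -/
theorem not_lyapunovStable_of_growth {X : ℝ × ℝ → ℝ × ℝ} {p : ℝ × ℝ} (hX : ContDiffAt ℝ 1 X p)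
    {s m : ℝ} (hs : s = 1 ∨ s = -1) (hm : 0 < m)
    (hgrow : ∀ᶠ z in 𝓝 p, m * (|z.1 - p.1| * |z.2 - p.2|) ≤
      s * ((X z).1 * (z.2 - p.2) + (z.1 - p.1) * (X z).2)) : ¬ LyapunovStable X p := by
  intro hstab
  obtain ⟨K, U, hU, hK⟩ := hX.exists_lipschitzOnWith
  obtain ⟨r, hr, hball⟩ := Metric.nhds_basis_closedBall.eventually_iff.1
    ((eventually_mem_set.2 hU).and hgrow)
  obtain ⟨η, hη, hst⟩ := hstab r hr
  set η' := min (η / 2) (r / 2) with hη'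
  have hη'0 : 0 < η' := lt_min (by linarith) (by linarith)
  -- The start lies on the diagonal where `s` times the coordinate product is positive, equal to `η'
  -- ^ 2`.
  set q : ℝ × ℝ := (p.1 + η', p.2 + s * η') with hq
  have hdq : dist q p = η' := by
    rw [Prod.dist_eq, Real.dist_eq, Real.dist_eq]
    rcases hs with h | h <;> simp [hq, h, abs_of_pos hη'0]
  -- Growth at rate at least `m * η' ^ 2` adds `2 * r ^ 2` in time `T`, more than the ball allows.
  set T : ℝ := 2 * r ^ 2 / (m * η' ^ 2) with hT
  have hT0 : 0 ≤ T := by positivity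
  obtain ⟨γ, hγ0, hγ⟩ := exists_solution_clamp hr.le (hK.mono fun z hz => (hball hz).1) q hT0
  have hγc : ContinuousOn γ (Icc 0 T) := fun t ht => (hγ t ht).continuousWithinAt
  -- Up to the first time `u` at distance `r` the clamped solution solves the original equation, so
  -- stability applies to it and excludes `u`.
  have hin : ∀ t ∈ Icc 0 T, dist (γ t) p < r := by
    by_contra! hcon
    obtain ⟨t, ht, htr⟩ := hcon
    have hsub : Icc 0 t ⊆ Icc 0 T := Icc_subset_Icc_right ht.2
    have hc : ContinuousOn (fun u => dist (γ u) p) (Icc 0 t) :=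
      fun v hv =>
      (hγc.mono hsub v hv).dist continuousWithinAt_const
    have hS : IsCompact {u ∈ Icc 0 t | r ≤ dist (γ u) p} := by
      have := hc.preimage_isClosed_of_isClosed isClosed_Icc (isClosed_Ici (a := r))
      exact isCompact_Icc.of_isClosed_subset this inter_subset_left
    obtain ⟨u, ⟨hu, hur⟩, hleast⟩ := hS.exists_isLeast ⟨t, ⟨ht.1, le_rfl⟩, htr⟩
    have hlt : ∀ v ∈ Ico 0 u, dist (γ v) p < r := fun v hv => by
      by_contra hv'
      exact absurd (hleast ⟨⟨hv.1, hv.2.le.trans hu.2⟩, not_lt.1 hv'⟩) (not_le.2 hv.2)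
    have hule : dist (γ u) p ≤ r := by
      rcases hu.1.eq_or_lt with h0 | h0
      · rw [← h0, hγ0, hdq]; linarith [min_le_right (η / 2) (r / 2)]
      · have hcu : ContinuousWithinAt (fun u => dist (γ u) p) (Ico 0 u) u :=
          (hc u hu).mono (fun v hv => ⟨hv.1, hv.2.le.trans hu.2⟩)
        have : (𝓝[Ico 0 u] u).NeBot := by
          rw [← mem_closure_iff_nhdsWithin_neBot, closure_Ico h0.ne]
          exact right_mem_Icc.2 h0.le
        exact le_of_tendsto hcu (eventually_nhdsWithin_of_forall fun v hv => (hlt v hv).le)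
    have hsolve : ∀ v ∈ Icc 0 u, HasDerivWithinAt γ (X (γ v)) (Icc 0 u) v := fun v hv => by
      have hvr : γ v ∈ closedBall p r := by
        rcases hv.2.eq_or_lt with h | h
        · rw [h]; exact mem_closedBall.2 hule
        · exact mem_closedBall.2 (hlt v ⟨hv.1, h⟩).le
      have := (hγ v (hsub ⟨hv.1, hv.2.trans hu.2⟩)).mono
        (Icc_subset_Icc_right (hu.2.trans ht.2))
      rwa [clamp_eq_self hvr] at this
    have := hst u γ hsolve (by rw [hγ0, hdq]; linarith [min_le_left (η / 2) (r / 2)]) u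
      (right_mem_Icc.2 hu.1)
    linarith
  set V : ℝ → ℝ := fun t => s * (((γ t).1 - p.1) * ((γ t).2 - p.2)) with hV
  have hVd : ∀ t ∈ Icc 0 T, HasDerivWithinAt V
      (s * ((X (γ t)).1 * ((γ t).2 - p.2) + ((γ t).1 - p.1) * (X (γ t)).2)) (Icc 0 T) t := by
    intro t ht
    have h := hγ t ht
    rw [clamp_eq_self (mem_closedBall.2 (hin t ht).le)] at h
    have h1 : HasDerivWithinAt (fun t => (γ t).1) (X (γ t)).1 (Icc 0 T) t :=
      (ContinuousLinearMap.fst ℝ ℝ ℝ).hasFDerivAt.comp_hasDerivWithinAt t h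
    have h2 : HasDerivWithinAt (fun t => (γ t).2) (X (γ t)).2 (Icc 0 T) t :=
      (ContinuousLinearMap.snd ℝ ℝ ℝ).hasFDerivAt.comp_hasDerivWithinAt t h
    exact ((h1.sub_const p.1).mul (h2.sub_const p.2)).const_mul s
  have hVg : ∀ t ∈ Icc 0 T, m * |V t| ≤
      s * ((X (γ t)).1 * ((γ t).2 - p.2) + ((γ t).1 - p.1) * (X (γ t)).2) := fun t ht => by
    have := (hball (mem_closedBall.2 (hin t ht).le)).2
    rwa [← abs_mul, show |((γ t).1 - p.1) * ((γ t).2 - p.2)| = |V t| by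
      rw [hV]; rcases hs with h | h <;> simp [h]] at this
  have hVc : ContinuousOn V (Icc 0 T) := fun t ht => (hVd t ht).continuousWithinAt
  have hint : ∀ t ∈ interior (Icc 0 T), HasDerivAt V
      (s * ((X (γ t)).1 * ((γ t).2 - p.2) + ((γ t).1 - p.1) * (X (γ t)).2)) t := fun t ht =>
    (hVd t (interior_subset ht)).hasDerivAt (mem_interior_iff_mem_nhds.1 ht)
  have hmono : MonotoneOn V (Icc 0 T) := by
    refine monotoneOn_of_deriv_nonneg (convex_Icc _ _) hVc
      (fun t ht => (hint t ht).differentiableAt.differentiableWithinAt) fun t ht => ?_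
    rw [(hint t ht).deriv]
    exact le_trans (by positivity) (hVg t (interior_subset ht))
  have hV0 : V 0 = η' ^ 2 := by
    simp only [hV, hγ0, hq]; rcases hs with h | h <;> rw [h] <;> ring
  have hlow : ∀ t ∈ Icc 0 T, η' ^ 2 ≤ V t := fun t ht =>
    hV0 ▸ hmono (left_mem_Icc.2 hT0) ht ht.1
  have hfin := (convex_Icc (0 : ℝ) T).mul_sub_le_image_sub_of_le_deriv hVc
    (fun t ht => (hint t ht).differentiableAt.differentiableWithinAt) (C := m * η' ^ 2)
    (fun t ht => by
      rw [(hint t ht).deriv]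
      refine le_trans ?_ (hVg t (interior_subset ht))
      exact mul_le_mul_of_nonneg_left
        ((hlow t (interior_subset ht)).trans (le_abs_self _)) hm.le)
    0 (left_mem_Icc.2 hT0) T (right_mem_Icc.2 hT0) hT0
  have hTe : m * η' ^ 2 * (T - 0) = 2 * r ^ 2 := by rw [hT]; field_simp; ring
  have hup : V T ≤ r ^ 2 := by
    have h := hin T (right_mem_Icc.2 hT0)
    rw [Prod.dist_eq, Real.dist_eq, Real.dist_eq, max_lt_iff] at h
    calc V T ≤ |V T| := le_abs_self _
      _ = |(γ T).1 - p.1| * |(γ T).2 - p.2| := by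
        rw [hV]; rcases hs with h | h <;> simp [h, abs_mul]
      _ ≤ r * r := mul_le_mul h.1.le h.2.le (abs_nonneg _) hr.le
      _ = r ^ 2 := by ring
  rw [hTe, hV0] at hfin
  nlinarith [sq_pos_of_pos hr, sq_pos_of_pos hη'0]

/-- The linear approximation of a planar field whose partial derivatives at a zero are
`(0, b)` and `(a, 0)`. -/
theorem eventually_linearization {X : ℝ × ℝ → ℝ × ℝ} {p : ℝ × ℝ} {a b : ℝ}
    (hX : DifferentiableAt ℝ X p) (h0 : X p = 0)
    (hx : HasDerivAt (fun x => X (x, p.2)) (0, b) p.1)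
    (hy : HasDerivAt (fun y => X (p.1, y)) (a, 0) p.2) {ε : ℝ} (hε : 0 < ε) :
    ∀ᶠ z in 𝓝 p, |(X z).1 - a * (z.2 - p.2)| ≤ ε * ‖z - p‖ ∧
      |(X z).2 - b * (z.1 - p.1)| ≤ ε * ‖z - p‖ := by
  have h1 : HasDerivAt (fun y : ℝ => (p.1, y)) (0, 1) p.2 :=
    (hasDerivAt_const _ _).prodMk (hasDerivAt_id _)
  have h2 : HasDerivAt (fun x : ℝ => (x, p.2)) (1, 0) p.1 :=
    (hasDerivAt_id _).prodMk (hasDerivAt_const _ _)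
  have e1 := (hX.hasFDerivAt.comp_hasDerivAt (f := fun y : ℝ => (p.1, y)) p.2 h1).unique hy
  have e2 := (hX.hasFDerivAt.comp_hasDerivAt (f := fun x : ℝ => (x, p.2)) p.1 h2).unique hx
  filter_upwards [hX.hasFDerivAt.isLittleO.def hε] with z hz
  have hw : fderiv ℝ X p (z - p) = (a * (z.2 - p.2), b * (z.1 - p.1)) := by
    have : z - p = (z.1 - p.1) • ((1 : ℝ), (0 : ℝ)) + (z.2 - p.2) • ((0 : ℝ), (1 : ℝ)) := by
      ext <;> simp
    rw [this, map_add, map_smul, map_smul, e1, e2]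
    ext <;> simp [mul_comm]
  rw [h0, sub_zero, hw, Prod.norm_def, max_le_iff] at hz
  exact hz

theorem sq_norm_le_add (w : ℝ × ℝ) : ‖w‖ ^ 2 ≤ w.1 ^ 2 + w.2 ^ 2 := by
  rw [Prod.norm_def, Real.norm_eq_abs, Real.norm_eq_abs]
  rcases max_cases |w.1| |w.2| with ⟨h, -⟩ | ⟨h, -⟩ <;> rw [h, sq_abs] <;>
    nlinarith [sq_nonneg w.1, sq_nonneg w.2]

/-- A perturbation of a positive definite diagonal quadratic form is positive definite. -/
theorem definite_lower_bound {a b' m ε : ℝ} (hm : 0 < m) (ha : m ≤ a) (hb : m ≤ b')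
    (hε : 4 * ε ≤ m) {w v : ℝ × ℝ} (h1 : |v.1 - a * w.2| ≤ ε * ‖w‖)
    (h2 : |v.2 - b' * w.1| ≤ ε * ‖w‖) :
    m / 2 * ‖w‖ ^ 2 ≤ v.1 * w.2 + w.1 * v.2 := by
  have hw1 : |w.1| ≤ ‖w‖ := by simpa using norm_fst_le w
  have hw2 : |w.2| ≤ ‖w‖ := by simpa using norm_snd_le w
  have hn := norm_nonneg w
  have e1 : |(v.1 - a * w.2) * w.2| ≤ ε * ‖w‖ * ‖w‖ := by
    rw [abs_mul]; exact mul_le_mul h1 hw2 (abs_nonneg _) ((abs_nonneg _).trans h1)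
  have e2 : |(v.2 - b' * w.1) * w.1| ≤ ε * ‖w‖ * ‖w‖ := by
    rw [abs_mul]; exact mul_le_mul h2 hw1 (abs_nonneg _) ((abs_nonneg _).trans h2)
  have e3 := (abs_le.1 e1).1
  have e4 := (abs_le.1 e2).1
  have e5 := sq_norm_le_add w
  have e6 : m * w.2 ^ 2 ≤ a * w.2 ^ 2 := mul_le_mul_of_nonneg_right ha (sq_nonneg _)
  have e7 : m * w.1 ^ 2 ≤ b' * w.1 ^ 2 := mul_le_mul_of_nonneg_right hb (sq_nonneg _)
  have e8 : m * ‖w‖ ^ 2 ≤ m * (w.1 ^ 2 + w.2 ^ 2) := mul_le_mul_of_nonneg_left e5 hm.le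
  have e9 : 4 * ε * ‖w‖ ^ 2 ≤ m * ‖w‖ ^ 2 := mul_le_mul_of_nonneg_right hε (sq_nonneg _)
  nlinarith

/-- A saddle of the Hamiltonian is unstable. -/
theorem not_lyapunovStable_hamField {H : ℝ × ℝ → ℝ} (hH : ContDiff ℝ 2 H) {p : ℝ × ℝ} {a b : ℝ}
    (h0 : hamField H p = 0) (hx : HasDerivAt (fun x => hamField H (x, p.2)) (0, b) p.1)
    (hy : HasDerivAt (fun y => hamField H (p.1, y)) (a, 0) p.2) (hab : 0 < a * b) :
    ¬ LyapunovStable (hamField H) p := by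
  have hX := contDiff_hamField hH
  -- For `ẋ = a y`, `ẏ = b x` the derivative of `x y` is `a y² + b x²`, which is definite when `a *
  -- b > 0`; `s` is its sign.
  obtain ⟨s, hs, hsa, hsb⟩ : ∃ s : ℝ, (s = 1 ∨ s = -1) ∧ 0 < s * a ∧ 0 < s * b := by
    rcases mul_pos_iff.1 hab with h | h
    · exact ⟨1, .inl rfl, by linarith, by linarith⟩
    · exact ⟨-1, .inr rfl, by linarith, by linarith⟩
  set m := min (s * a) (s * b) with hm
  have hm0 : 0 < m := lt_min hsa hsb
  have hss : |s| = 1 := by rcases hs with h | h <;> simp [h]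
  refine not_lyapunovStable_of_growth hX.contDiffAt hs (half_pos hm0) ?_
  filter_upwards [eventually_linearization (hX.differentiable one_ne_zero p) h0 hx hy
    (show 0 < m / 4 by linarith)] with z hz
  have key := definite_lower_bound (ε := m / 4) (w := z - p)
    (v := (s * (hamField H z).1, s * (hamField H z).2)) hm0 (min_le_left _ _) (min_le_right _ _)
    (by linarith)
    (by
      simp only [Prod.snd_sub]
      rw [mul_assoc, ← mul_sub, abs_mul, hss, one_mul]; exact hz.1)
    (by
      simp only [Prod.fst_sub]
      rw [mul_assoc, ← mul_sub, abs_mul, hss, one_mul]; exact hz.2)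
  have hw1 : |z.1 - p.1| ≤ ‖z - p‖ := by simpa using norm_fst_le (z - p)
  have hw2 : |z.2 - p.2| ≤ ‖z - p‖ := by simpa using norm_snd_le (z - p)
  have h3 : |z.1 - p.1| * |z.2 - p.2| ≤ ‖z - p‖ ^ 2 := by
    rw [sq]; exact mul_le_mul hw1 hw2 (abs_nonneg _) (norm_nonneg _)
  have h4 := mul_le_mul_of_nonneg_left h3 (half_pos hm0).le
  simp only [Prod.fst_sub, Prod.snd_sub] at key
  linarith

/-- A nondegenerate extremum of the Hamiltonian is stable. -/
theorem lyapunovStable_hamField {H : ℝ × ℝ → ℝ} (hH : ContDiff ℝ 2 H) {p : ℝ × ℝ} {a b : ℝ}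
    (h0 : hamField H p = 0) (hx : HasDerivAt (fun x => hamField H (x, p.2)) (0, b) p.1)
    (hy : HasDerivAt (fun y => hamField H (p.1, y)) (a, 0) p.2) (hab : a * b < 0) :
    LyapunovStable (hamField H) p := by
  have hX := contDiff_hamField hH
  have hHd : Differentiable ℝ H := hH.differentiable (by norm_num)
  obtain ⟨s, hs, hsa, hsb⟩ : ∃ s : ℝ, (s = 1 ∨ s = -1) ∧ 0 < s * a ∧ 0 < -s * b := by
    rcases mul_neg_iff.1 hab with h | h
    · exact ⟨1, .inl rfl, by linarith, by linarith⟩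
    · exact ⟨-1, .inr rfl, by linarith, by linarith⟩
  set m := min (s * a) (-s * b) with hm
  have hm0 : 0 < m := lt_min hsa hsb
  have hss : |s| = 1 := by rcases hs with h | h <;> simp [h]
  have hss' : |-s| = 1 := by rw [abs_neg, hss]
  refine lyapunovStable_of_firstIntegral (V := fun z => s * H z) (hHd.const_mul s)
    (fun z => ?_) ?_
  · rw [fderiv_const_mul (hHd z), smul_apply, fderiv_apply_eq_hamField hHd]
    simp only [smul_eq_mul]; ring
  obtain ⟨r, hr, hball⟩ := Metric.eventually_nhds_iff_ball.1
    (eventually_linearization (hX.differentiable one_ne_zero p) h0 hx hy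
    (show 0 < m / 4 by linarith))
  filter_upwards [ball_mem_nhds p hr] with z hz hne
  set w := z - p with hw
  have hwn : 0 < ‖w‖ := norm_pos_iff.2 (sub_ne_zero.2 hne)
  have hline : ∀ t : ℝ, HasDerivAt (fun t : ℝ => s * H (p + t • w))
      (s * fderiv ℝ H (p + t • w) w) t := fun t => by
    have h1 : HasDerivAt (fun t : ℝ => p + t • w) w t := by
      simpa using ((hasDerivAt_id t).smul_const w).const_add p
    exact ((hHd _).hasFDerivAt.comp_hasDerivAt t h1).const_mul s
  -- `s * H` increases along every ray from `p`, so `p` is a strict local minimum of it.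
  have hmono : StrictMonoOn (fun t : ℝ => s * H (p + t • w)) (Icc 0 1) := by
    refine strictMonoOn_of_deriv_pos (convex_Icc _ _)
      (fun t _ => (hline t).continuousAt.continuousWithinAt) fun t ht => ?_
    rw [interior_Icc] at ht
    rw [(hline t).deriv, fderiv_apply_eq_hamField hHd]
    have hzt : p + t • w ∈ ball p r := by
      rw [mem_ball, dist_eq_norm, add_sub_cancel_left, norm_smul, Real.norm_of_nonneg ht.1.le]
      rw [mem_ball, dist_eq_norm] at hz
      exact lt_of_le_of_lt (mul_le_of_le_one_left (norm_nonneg _) ht.2.le) hz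
    obtain ⟨z1, z2⟩ := hball _ hzt
    set u := p + t • w with hu
    have key := definite_lower_bound (ε := m / 4) (w := u - p)
      (v := (s * (hamField H u).1, -s * (hamField H u).2)) hm0 (min_le_left _ _)
      (min_le_right _ _) (by linarith)
      (by
        simp only [Prod.snd_sub]
        rw [mul_assoc, ← mul_sub, abs_mul, hss, one_mul]; exact z1)
      (by
        simp only [Prod.fst_sub]
        rw [mul_assoc, ← mul_sub, abs_mul, hss', one_mul]; exact z2)
    rw [hu, add_sub_cancel_left, norm_smul, Real.norm_of_nonneg ht.1.le] at key
    simp only [Prod.smul_fst, Prod.smul_snd, smul_eq_mul] at key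
    -- The estimate at `p + t • w` concerns the displacement `t • w`, so it bounds `t` times the
    -- derivative along the ray.
    have h5 : 0 < m / 2 * (t * ‖w‖) ^ 2 := by have := ht.1; positivity
    refine pos_of_mul_pos_right (a := t) ?_ ht.1.le
    linarith
  have := hmono (left_mem_Icc.2 zero_le_one) (right_mem_Icc.2 zero_le_one) zero_lt_one
  simpa [hw] using this

/-! ### Even polynomial Hamiltonians -/

/-- This removes the angle, which is not smooth at the origin, in favour of a polynomial. -/
theorem norm_sq_mul_cos_two_angle (z : ℝ × ℝ) :
    (z.1 ^ 2 + z.2 ^ 2) / 2 * Real.cos (2 * angle z) = (z.1 ^ 2 - z.2 ^ 2) / 2 := by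
  have h1 : ‖(⟨z.1, z.2⟩ : ℂ)‖ * Real.cos (angle z) = z.1 := Complex.norm_mul_cos_arg _
  have h2 : ‖(⟨z.1, z.2⟩ : ℂ)‖ ^ 2 = z.1 ^ 2 + z.2 ^ 2 := by
    rw [Complex.sq_norm, Complex.normSq_mk]; ring
  rw [Real.cos_two_mul]
  have h3 : (z.1 ^ 2 + z.2 ^ 2) * Real.cos (angle z) ^ 2 = z.1 ^ 2 := by
    rw [← h2, ← mul_pow, h1]
  linear_combination h3

/-- A planar Hamiltonian that is even in both variables, in the form
`P(J) + T(J) (x ^ 2 - y ^ 2) / 2` with `J = (x ^ 2 + y ^ 2) / 2`. -/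
def evenH (k a₁ a₂ a₃ t₀ t₁ t₂ : ℝ) (z : ℝ × ℝ) : ℝ :=
  k + a₁ * ((z.1 ^ 2 + z.2 ^ 2) / 2) + a₂ * ((z.1 ^ 2 + z.2 ^ 2) / 2) ^ 2
    + a₃ * ((z.1 ^ 2 + z.2 ^ 2) / 2) ^ 3
    + (t₀ + t₁ * ((z.1 ^ 2 + z.2 ^ 2) / 2) + t₂ * ((z.1 ^ 2 + z.2 ^ 2) / 2) ^ 2)
      * ((z.1 ^ 2 - z.2 ^ 2) / 2)

/-- The factor of `x` in `∂H/∂x` for `H = evenH k a₁ a₂ a₃ t₀ t₁ t₂`; that of `y` in `∂H/∂y` is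
obtained by changing the signs of the `tᵢ` and interchanging the variables. -/
def evenG (a₁ a₂ a₃ t₀ t₁ t₂ x y : ℝ) : ℝ :=
  a₁ + 2 * a₂ * ((x ^ 2 + y ^ 2) / 2) + 3 * a₃ * ((x ^ 2 + y ^ 2) / 2) ^ 2
    + (t₁ + 2 * t₂ * ((x ^ 2 + y ^ 2) / 2)) * ((x ^ 2 - y ^ 2) / 2)
    + (t₀ + t₁ * ((x ^ 2 + y ^ 2) / 2) + t₂ * ((x ^ 2 + y ^ 2) / 2) ^ 2)

theorem contDiff_evenH (k a₁ a₂ a₃ t₀ t₁ t₂ : ℝ) : ContDiff ℝ 2 (evenH k a₁ a₂ a₃ t₀ t₁ t₂) := by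
  unfold evenH; fun_prop

/-- Exchanging the variables reverses `cos 2ψ`, so derivatives in `y` reduce to derivatives in `x`.
-/
theorem evenH_swap (k a₁ a₂ a₃ t₀ t₁ t₂ x y : ℝ) :
    evenH k a₁ a₂ a₃ t₀ t₁ t₂ (x, y) = evenH k a₁ a₂ a₃ (-t₀) (-t₁) (-t₂) (y, x) := by
  simp only [evenH]; ring

theorem hasDerivAt_evenH (k a₁ a₂ a₃ t₀ t₁ t₂ x y : ℝ) :
    HasDerivAt (fun x => evenH k a₁ a₂ a₃ t₀ t₁ t₂ (x, y))
      (x * evenG a₁ a₂ a₃ t₀ t₁ t₂ x y) x := by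
  have h2 : HasDerivAt (fun x : ℝ => x ^ 2) (2 * x) x := by simpa using hasDerivAt_pow 2 x
  have hJ : HasDerivAt (fun x : ℝ => (x ^ 2 + y ^ 2) / 2) x x := by
    exact ((h2.add_const (y ^ 2)).div_const 2).congr_deriv (by ring)
  have hD : HasDerivAt (fun x : ℝ => (x ^ 2 - y ^ 2) / 2) x x := by
    exact ((h2.sub_const (y ^ 2)).div_const 2).congr_deriv (by ring)
  have h := ((((hJ.const_mul a₁).const_add k).add ((hJ.pow 2).const_mul a₂)).add
    ((hJ.pow 3).const_mul a₃)).add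
    ((((hJ.const_mul t₁).const_add t₀).add ((hJ.pow 2).const_mul t₂)).mul hD)
  refine h.congr_deriv ?_
  simp only [evenG, Pi.add_apply, Pi.pow_apply]; push_cast; ring

theorem hamField_evenH (k a₁ a₂ a₃ t₀ t₁ t₂ x y : ℝ) :
    hamField (evenH k a₁ a₂ a₃ t₀ t₁ t₂) (x, y) =
      (y * evenG a₁ a₂ a₃ (-t₀) (-t₁) (-t₂) y x, -(x * evenG a₁ a₂ a₃ t₀ t₁ t₂ x y)) := by
  simp only [hamField, (hasDerivAt_evenH k a₁ a₂ a₃ t₀ t₁ t₂ x y).deriv,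
    evenH_swap k a₁ a₂ a₃ t₀ t₁ t₂ x, (hasDerivAt_evenH k a₁ a₂ a₃ (-t₀) (-t₁) (-t₂) y x).deriv]

theorem hasDerivAt_mul_evenG (a₁ a₂ a₃ t₀ t₁ t₂ x : ℝ) :
    HasDerivAt (fun x => x * evenG a₁ a₂ a₃ t₀ t₁ t₂ x 0)
      (evenG a₁ a₂ a₃ t₀ t₁ t₂ x 0 + x ^ 2 * (2 * (a₂ + t₁) + 3 * (a₃ + t₂) * x ^ 2)) x := by
  have h2 : HasDerivAt (fun x : ℝ => x ^ 2) (2 * x) x := by simpa using hasDerivAt_pow 2 x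
  have h := (hasDerivAt_id x).mul
    (((h2.const_mul (a₂ + t₁)).add ((h2.pow 2).const_mul (3 / 4 * (a₃ + t₂)))).const_add (a₁ + t₀))
  refine (h.congr_deriv ?_).congr_of_eventuallyEq (.of_forall fun x => ?_)
  · simp only [evenG, Pi.add_apply, Pi.pow_apply, id]; push_cast; ring
  · simp only [evenG, Pi.mul_apply, Pi.add_apply, Pi.pow_apply, id]; ring

theorem hasDerivAt_evenG_snd (a₁ a₂ a₃ t₀ t₁ t₂ x : ℝ) :
    HasDerivAt (fun y => evenG a₁ a₂ a₃ t₀ t₁ t₂ x y) 0 0 := by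
  have h2 : HasDerivAt (fun x : ℝ => x ^ 2) 0 0 := by simpa using hasDerivAt_pow 2 (0 : ℝ)
  have h := ((h2.const_mul (a₂ + 3 / 2 * a₃ * x ^ 2 + t₂ * x ^ 2 / 2)).add
    ((h2.pow 2).const_mul (3 / 4 * a₃ - t₂ / 4))).const_add (evenG a₁ a₂ a₃ t₀ t₁ t₂ x 0)
  refine (h.congr_deriv ?_).congr_of_eventuallyEq (.of_forall fun x => ?_)
  · simp
  · simp only [evenG, Pi.add_apply, Pi.pow_apply]; ring

theorem hasDerivAt_mul_evenG_snd (a₁ a₂ a₃ t₀ t₁ t₂ x : ℝ) :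
    HasDerivAt (fun y => y * evenG a₁ a₂ a₃ t₀ t₁ t₂ y x) (evenG a₁ a₂ a₃ t₀ t₁ t₂ 0 x) 0 := by
  have hd : Differentiable ℝ fun y => evenG a₁ a₂ a₃ t₀ t₁ t₂ y x := by unfold evenG; fun_prop
  exact ((hasDerivAt_id (0 : ℝ)).mul (hd 0).hasDerivAt).congr_deriv (by simp)

section

variable (k a₁ a₂ a₃ t₀ t₁ t₂ : ℝ)

theorem evenH_origin :
    hamField (evenH k a₁ a₂ a₃ t₀ t₁ t₂) 0 = 0 ∧
    HasDerivAt (fun x => hamField (evenH k a₁ a₂ a₃ t₀ t₁ t₂) (x, (0 : ℝ × ℝ).2))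
      (0, -(a₁ + t₀)) (0 : ℝ × ℝ).1 ∧
    HasDerivAt (fun y => hamField (evenH k a₁ a₂ a₃ t₀ t₁ t₂) ((0 : ℝ × ℝ).1, y))
      (a₁ - t₀, 0) (0 : ℝ × ℝ).2 := by
  refine ⟨?_, ?_, ?_⟩
  · rw [← Prod.mk_zero_zero, hamField_evenH]; simp
  · simp only [hamField_evenH, Prod.snd_zero, Prod.fst_zero, zero_mul]
    have h := (hasDerivAt_mul_evenG_snd a₁ a₂ a₃ t₀ t₁ t₂ 0).fun_neg
    exact (hasDerivAt_const _ _).prodMk (h.congr_deriv (by simp [evenG]))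
  · simp only [hamField_evenH, Prod.snd_zero, Prod.fst_zero, zero_mul, neg_zero]
    have h := (hasDerivAt_mul_evenG_snd a₁ a₂ a₃ (-t₀) (-t₁) (-t₂) 0)
    exact (h.congr_deriv (by simp [evenG]; ring)).prodMk (hasDerivAt_const _ _)

/-- Evenness kills the mixed derivative. On the axis the factors of `y` in `∂H/∂y` and of `x` in
`∂H/∂x` differ by `-2T(J)`, and the latter vanishes at the point; this gives the transversal
coefficient. -/
theorem evenH_inclined {r : ℝ} (h0 : evenG a₁ a₂ a₃ t₀ t₁ t₂ r 0 = 0) :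
    hamField (evenH k a₁ a₂ a₃ t₀ t₁ t₂) (r, 0) = 0 ∧
    HasDerivAt (fun x => hamField (evenH k a₁ a₂ a₃ t₀ t₁ t₂) (x, ((r, 0) : ℝ × ℝ).2))
      (0, -(r ^ 2 * (2 * (a₂ + t₁) + 3 * (a₃ + t₂) * r ^ 2))) ((r, 0) : ℝ × ℝ).1 ∧
    HasDerivAt (fun y => hamField (evenH k a₁ a₂ a₃ t₀ t₁ t₂) (((r, 0) : ℝ × ℝ).1, y))
      (-2 * (t₀ + t₁ * (r ^ 2 / 2) + t₂ * (r ^ 2 / 2) ^ 2), 0) ((r, 0) : ℝ × ℝ).2 := by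
  refine ⟨?_, ?_, ?_⟩
  · rw [hamField_evenH, h0]; simp
  · simp only [hamField_evenH, zero_mul]
    have h := (hasDerivAt_mul_evenG a₁ a₂ a₃ t₀ t₁ t₂ r).fun_neg
    rw [h0, zero_add] at h
    exact (hasDerivAt_const _ _).prodMk h
  · simp only [hamField_evenH]
    have h1 := (hasDerivAt_mul_evenG_snd a₁ a₂ a₃ (-t₀) (-t₁) (-t₂) r)
    have h2 := ((hasDerivAt_evenG_snd a₁ a₂ a₃ t₀ t₁ t₂ r).const_mul r).fun_neg
    refine (h1.congr_deriv ?_).prodMk (h2.congr_deriv (by simp))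
    unfold evenG at h0 ⊢
    linear_combination h0

theorem evenH_loop {r : ℝ} (h0 : evenG a₁ a₂ a₃ (-t₀) (-t₁) (-t₂) r 0 = 0) :
    hamField (evenH k a₁ a₂ a₃ t₀ t₁ t₂) (0, r) = 0 ∧
    HasDerivAt (fun x => hamField (evenH k a₁ a₂ a₃ t₀ t₁ t₂) (x, ((0, r) : ℝ × ℝ).2))
      (0, -2 * (t₀ + t₁ * (r ^ 2 / 2) + t₂ * (r ^ 2 / 2) ^ 2)) ((0, r) : ℝ × ℝ).1 ∧
    HasDerivAt (fun y => hamField (evenH k a₁ a₂ a₃ t₀ t₁ t₂) (((0, r) : ℝ × ℝ).1, y))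
      (r ^ 2 * (2 * (a₂ - t₁) + 3 * (a₃ - t₂) * r ^ 2), 0) ((0, r) : ℝ × ℝ).2 := by
  refine ⟨?_, ?_, ?_⟩
  · rw [hamField_evenH, h0]; simp
  · simp only [hamField_evenH]
    have h1 := (hasDerivAt_mul_evenG_snd a₁ a₂ a₃ t₀ t₁ t₂ r).fun_neg
    have h2 := (hasDerivAt_evenG_snd a₁ a₂ a₃ (-t₀) (-t₁) (-t₂) r).const_mul r
    refine (h2.congr_deriv (by simp)).prodMk (h1.congr_deriv ?_)
    unfold evenG at h0 ⊢
    linear_combination -h0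
  · simp only [hamField_evenH, zero_mul, neg_zero]
    have h := hasDerivAt_mul_evenG a₁ a₂ a₃ (-t₀) (-t₁) (-t₂) r
    rw [h0, zero_add] at h
    exact (h.congr_deriv (by ring)).prodMk (hasDerivAt_const _ _)

end

/-! ### The two charts and the linearization at fixed points -/

theorem planarK_one (c : Coeffs) (δ E : ℝ) :
    planarK c δ E .one = evenH (E + (termA1 c δ E 0 + termA2 c δ E 0)) (lin c δ E) (quad c δ E)
      c.cJJJ (E * coupling c δ E 0) (E * c.dJ - coupling c δ E 0) (-c.dJ) := by
  funext z
  have h := norm_sq_mul_cos_two_angle z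
  simp only [planarK, reducedK, evenH]
  have hA := termA_eq c δ E ((z.1 ^ 2 + z.2 ^ 2) / 2)
  have hB := termB_eq c δ E ((z.1 ^ 2 + z.2 ^ 2) / 2)
  have hc : coupling c δ E ((z.1 ^ 2 + z.2 ^ 2) / 2) =
    coupling c δ E 0 + c.dJ * ((z.1 ^ 2 + z.2 ^ 2) / 2) := by simp only [coupling]; ring
  rw [hc] at hB
  generalize (z.1 ^ 2 + z.2 ^ 2) / 2 = J at *
  generalize Real.cos (2 * angle z) = C at *
  rw [← h]
  linear_combination hA + C * hB

/-- Replacing `J` by `E - J` only exchanges the factors of `J * (E - J)`, so mode two is treated by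
the same even form; the reversed orientation changes the overall sign. -/
theorem neg_planarK_two (c : Coeffs) (δ E : ℝ) :
    (fun z => -planarK c δ E .two z) = evenH
      (-(E + (termA1 c δ E 0 + termA2 c δ E 0) + lin c δ E * E + quad c δ E * E ^ 2
        + c.cJJJ * E ^ 3))
      (lin c δ E + 2 * quad c δ E * E + 3 * c.cJJJ * E ^ 2) (-(quad c δ E + 3 * c.cJJJ * E))
      c.cJJJ (-(E * coupling c δ E E)) (coupling c δ E E + E * c.dJ) (-c.dJ) := by
  funext z
  have h := norm_sq_mul_cos_two_angle z
  simp only [planarK, reducedK, evenH]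
  have hA := termA_eq c δ E (E - (z.1 ^ 2 + z.2 ^ 2) / 2)
  have hB := termB_eq c δ E (E - (z.1 ^ 2 + z.2 ^ 2) / 2)
  have hc : coupling c δ E (E - (z.1 ^ 2 + z.2 ^ 2) / 2) =
    coupling c δ E E - c.dJ * ((z.1 ^ 2 + z.2 ^ 2) / 2) := by simp only [coupling]; ring
  rw [hc] at hB
  generalize (z.1 ^ 2 + z.2 ^ 2) / 2 = J at *
  generalize Real.cos (2 * angle z) = C at *
  rw [← h]
  linear_combination -hA - C * hB

/-- At a zero of one family's slope this determines the sign of the other's, hence both the order of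
the bifurcations and the stability of the mode. -/
theorem slopeK_other_one (c : Coeffs) (F : Family) (δ E : ℝ) :
    slopeK c F.other δ E 0 = slopeK c F δ E 0 - 2 * E * (F.sign * coupling c δ E 0) := by
  cases F <;> simp only [slopeK, Family.other, Family.sign] <;> ring

theorem slopeK_other_two (c : Coeffs) (F : Family) (δ E : ℝ) :
    slopeK c F.other δ E E = slopeK c F δ E E + 2 * E * (F.sign * coupling c δ E E) := by
  cases F <;> simp only [slopeK, Family.other, Family.sign] <;> ring

/-- The linearization at a mode is `ẋ = a y`, `ẏ = b x`, with `a` the slope of the loops and `-b`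
that of the inclined family. -/
theorem lyapunovStable_mode (c : Coeffs) (δ E : ℝ) (m : Mode) (F : Family)
    (h : 0 < slopeK c F δ E (m.action E) * slopeK c F.other δ E (m.action E)) :
    LyapunovStable (chartField c δ E m) 0 := by
  cases m
  · simp only [chartField, planarK_one]
    obtain ⟨h0, hx, hy⟩ := evenH_origin (E + (termA1 c δ E 0 + termA2 c δ E 0)) (lin c δ E)
      (quad c δ E) c.cJJJ (E * coupling c δ E 0) (E * c.dJ - coupling c δ E 0) (-c.dJ)
    refine lyapunovStable_hamField (contDiff_evenH ..) h0 hx hy ?_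
    cases F <;> simp only [slopeK, Family.other, Family.sign, Mode.action] at h <;> linarith
  · simp only [chartField, neg_planarK_two]
    obtain ⟨h0, hx, hy⟩ := evenH_origin
      (-(E + (termA1 c δ E 0 + termA2 c δ E 0) + lin c δ E * E + quad c δ E * E ^ 2
        + c.cJJJ * E ^ 3))
      (lin c δ E + 2 * quad c δ E * E + 3 * c.cJJJ * E ^ 2) (-(quad c δ E + 3 * c.cJJJ * E))
      c.cJJJ (-(E * coupling c δ E E)) (coupling c δ E E + E * c.dJ) (-c.dJ)
    refine lyapunovStable_hamField (contDiff_evenH ..) h0 hx hy ?_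
    cases F <;> simp only [slopeK, Family.other, Family.sign, Mode.action] at h <;> linarith

theorem not_lyapunovStable_mode (c : Coeffs) (δ E : ℝ) (m : Mode) (F : Family)
    (h : slopeK c F δ E (m.action E) * slopeK c F.other δ E (m.action E) < 0) :
    ¬ LyapunovStable (chartField c δ E m) 0 := by
  cases m
  · simp only [chartField, planarK_one]
    obtain ⟨h0, hx, hy⟩ := evenH_origin (E + (termA1 c δ E 0 + termA2 c δ E 0)) (lin c δ E)
      (quad c δ E) c.cJJJ (E * coupling c δ E 0) (E * c.dJ - coupling c δ E 0) (-c.dJ)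
    refine not_lyapunovStable_hamField (contDiff_evenH ..) h0 hx hy ?_
    cases F <;> simp only [slopeK, Family.other, Family.sign, Mode.action] at h <;> linarith
  · simp only [chartField, neg_planarK_two]
    obtain ⟨h0, hx, hy⟩ := evenH_origin
      (-(E + (termA1 c δ E 0 + termA2 c δ E 0) + lin c δ E * E + quad c δ E * E ^ 2
        + c.cJJJ * E ^ 3))
      (lin c δ E + 2 * quad c δ E * E + 3 * c.cJJJ * E ^ 2) (-(quad c δ E + 3 * c.cJJJ * E))
      c.cJJJ (-(E * coupling c δ E E)) (coupling c δ E E + E * c.dJ) (-c.dJ)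
    refine not_lyapunovStable_hamField (contDiff_evenH ..) h0 hx hy ?_
    cases F <;> simp only [slopeK, Family.other, Family.sign, Mode.action] at h <;> linarith

/-- The point of the axis of the family with coordinate `r`. -/
def Family.axisPoint : Family → ℝ → ℝ × ℝ
  | .inclined, r => (r, 0)
  | .loop, r => (0, r)

theorem Family.mem_axis {F : Family} {z : ℝ × ℝ} : z ∈ F.axis ↔ ∃ r, z = F.axisPoint r := by
  cases F
  · exact ⟨fun h => ⟨z.1, Prod.ext rfl h⟩, by rintro ⟨r, rfl⟩; rfl⟩
  · exact ⟨fun h => ⟨z.2, Prod.ext h rfl⟩, by rintro ⟨r, rfl⟩; rfl⟩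

theorem Family.sq_axisPoint (F : Family) (r : ℝ) :
    (F.axisPoint r).1 ^ 2 + (F.axisPoint r).2 ^ 2 = r ^ 2 := by
  cases F <;> simp [Family.axisPoint]

theorem Family.neg_axisPoint (F : Family) (r : ℝ) : -F.axisPoint r = F.axisPoint (-r) := by
  cases F <;> simp [Family.axisPoint]

theorem chartField_axisPoint (c : Coeffs) (δ E : ℝ) (F : Family) {r : ℝ} (hr : r ≠ 0) :
    chartField c δ E .one (F.axisPoint r) = 0 ↔ slopeK c F δ E (r ^ 2 / 2) = 0 := by
  simp only [chartField, planarK_one]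
  cases F
  · rw [show Family.inclined.axisPoint r = (r, 0) from rfl, hamField_evenH]
    simp only [Prod.mk_eq_zero, zero_mul, true_and, neg_eq_zero, mul_eq_zero, hr, false_or]
    have : ∀ a b : ℝ, a = b → (a = 0 ↔ b = 0) := by rintro a b rfl; rfl
    apply this
    simp only [evenG, slopeK, Family.sign, coupling]; ring
  · rw [show Family.loop.axisPoint r = (0, r) from rfl, hamField_evenH]
    simp only [Prod.mk_eq_zero, zero_mul, and_true, neg_zero, mul_eq_zero, hr, false_or]
    have : ∀ a b : ℝ, a = b → (a = 0 ↔ b = 0) := by rintro a b rfl; rfl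
    apply this
    simp only [evenG, slopeK, Family.sign, coupling]; ring

/-- The tangential second derivative comes from the curvature, the transversal one from the
coupling; only their product matters for stability. -/
theorem axisPoint_linearization (c : Coeffs) (δ E : ℝ) (F : Family) {r : ℝ}
    (h : slopeK c F δ E (r ^ 2 / 2) = 0) :
    ∃ a b : ℝ, a * b = 2 * r ^ 2 * (E - r ^ 2 / 2) * (F.sign * coupling c δ E (r ^ 2 / 2))
        * curvK c F δ E (r ^ 2 / 2) (r ^ 2 / 2) ∧
      chartField c δ E .one (F.axisPoint r) = 0 ∧
      HasDerivAt (fun x => chartField c δ E .one (x, (F.axisPoint r).2)) (0, b)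
        (F.axisPoint r).1 ∧
      HasDerivAt (fun y => chartField c δ E .one ((F.axisPoint r).1, y)) (a, 0)
        (F.axisPoint r).2 := by
  simp only [chartField, planarK_one]
  cases F
  · refine ⟨_, _, ?_, evenH_inclined _ _ _ _ _ _ _ ?_⟩
    · simp only [curvK, Family.sign, coupling]; ring
    · refine Eq.trans ?_ h
      simp only [evenG, slopeK, Family.sign, coupling]; ring
  · refine ⟨_, _, ?_, evenH_loop _ _ _ _ _ _ _ ?_⟩
    · simp only [curvK, Family.sign, coupling]; ring
    · refine Eq.trans ?_ h
      simp only [evenG, slopeK, Family.sign, coupling]; ring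

theorem lyapunovStable_axisPoint (c : Coeffs) (δ E : ℝ) (F : Family) {r : ℝ} (hr : r ≠ 0)
    (hrE : r ^ 2 / 2 < E) (h : slopeK c F δ E (r ^ 2 / 2) = 0)
    (hcurv : curvK c F δ E (r ^ 2 / 2) (r ^ 2 / 2) < 0)
    (hcoup : 0 < F.sign * coupling c δ E (r ^ 2 / 2)) :
    LyapunovStable (chartField c δ E .one) (F.axisPoint r) := by
  obtain ⟨a, b, hab, h0, hx, hy⟩ := axisPoint_linearization c δ E F h
  have hH : ContDiff ℝ 2 (planarK c δ E .one) := by rw [planarK_one]; exact contDiff_evenH ..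
  refine lyapunovStable_hamField hH h0 hx hy ?_
  have h1 : 0 < E - r ^ 2 / 2 := by linarith
  rw [hab]
  exact mul_neg_of_pos_of_neg (by positivity) hcurv

theorem not_lyapunovStable_axisPoint (c : Coeffs) (δ E : ℝ) (F : Family) {r : ℝ} (hr : r ≠ 0)
    (hrE : r ^ 2 / 2 < E) (h : slopeK c F δ E (r ^ 2 / 2) = 0)
    (hcurv : curvK c F δ E (r ^ 2 / 2) (r ^ 2 / 2) < 0)
    (hcoup : F.sign * coupling c δ E (r ^ 2 / 2) < 0) :
    ¬ LyapunovStable (chartField c δ E .one) (F.axisPoint r) := by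
  obtain ⟨a, b, hab, h0, hx, hy⟩ := axisPoint_linearization c δ E F h
  have hH : ContDiff ℝ 2 (planarK c δ E .one) := by rw [planarK_one]; exact contDiff_evenH ..
  refine not_lyapunovStable_hamField hH h0 hx hy ?_
  have h1 : 0 < E - r ^ 2 / 2 := by linarith
  rw [hab]
  exact mul_pos_of_neg_of_neg (mul_neg_of_pos_of_neg (by positivity) hcoup) hcurv

theorem mem_familyPoints {c : Coeffs} {δ E : ℝ} {F : Family} {z : ℝ × ℝ} :
    z ∈ familyPoints c δ E F ↔ ∃ r, z = F.axisPoint r ∧ r ≠ 0 ∧ r ^ 2 / 2 < E ∧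
      slopeK c F δ E (r ^ 2 / 2) = 0 := by
  simp only [familyPoints, fixedPoints, mem_inter_iff, mem_ofPred_eq, Family.mem_axis]
  constructor
  · rintro ⟨⟨h1, h2, h3⟩, r, rfl⟩
    rw [Family.sq_axisPoint] at h1 h2
    have hr : r ≠ 0 := by rintro rfl; simp at h1
    exact ⟨r, rfl, hr, by linarith, (chartField_axisPoint c δ E F hr).1 h3⟩
  · rintro ⟨r, rfl, hr, h2, h3⟩
    rw [Family.sq_axisPoint]
    exact ⟨⟨by positivity, by linarith, (chartField_axisPoint c δ E F hr).2 h3⟩, r, rfl⟩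

/-- Off the axes there are no fixed points where the coupling does not vanish. -/
theorem fixedPoints_eq_union {c : Coeffs} {δ E : ℝ}
    (hc : ∀ J ∈ Ioo 0 E, coupling c δ E J ≠ 0) :
    fixedPoints c δ E = familyPoints c δ E .inclined ∪ familyPoints c δ E .loop := by
  refine Subset.antisymm (fun z hz => ?_) (union_subset inter_subset_left inter_subset_left)
  by_contra hcon
  have hx : z.1 ≠ 0 := fun h => hcon (.inr ⟨hz, h⟩)
  have hy : z.2 ≠ 0 := fun h => hcon (.inl ⟨hz, h⟩)
  obtain ⟨h1, h2, h3⟩ := hz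
  have hJ : (z.1 ^ 2 + z.2 ^ 2) / 2 ∈ Ioo 0 E := ⟨by linarith, by linarith⟩
  rw [chartField, planarK_one, ← Prod.mk.eta (p := z), hamField_evenH] at h3
  simp only [Prod.mk_eq_zero, neg_eq_zero, mul_eq_zero, hx, hy, false_or] at h3
  -- Off the axes both factors `evenG` vanish, and half their difference is `(E - J) * coupling`.
  have h4 : (E - (z.1 ^ 2 + z.2 ^ 2) / 2) * coupling c δ E ((z.1 ^ 2 + z.2 ^ 2) / 2) = 0 := by
    have := h3.2.trans h3.1.symm
    simp only [evenG, coupling] at this ⊢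
    linear_combination this / 2
  rcases mul_eq_zero.1 h4 with h | h
  · linarith [hJ.2]
  · exact hc _ hJ h

/-! ### The pairs of fixed points at a given energy -/

theorem continuous_slopeK (c : Coeffs) (F : Family) (δ : ℝ) :
    Continuous fun q : ℝ × ℝ => slopeK c F δ q.1 q.2 := by
  unfold slopeK lin quad coupling; fun_prop

theorem slopeK_lt {c : Coeffs} {F : Family} {δ E J J' : ℝ} (h : J < J')
    (hcurv : curvK c F δ E J' J < 0) : slopeK c F δ E J' < slopeK c F δ E J := by
  have := slopeK_sub c F δ E J' J
  nlinarith [mul_neg_of_pos_of_neg (sub_pos.2 h) hcurv]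

theorem familyStability_eq_stable {c : Coeffs} {F : Family} (h : 0 < F.sign * c.C) :
    familyStability c F = .stable := by
  cases F <;> simp only [Family.sign] at h <;> simp only [familyStability]
  · rw [if_pos (by linarith)]
  · rw [if_neg (by linarith)]

theorem familyStability_eq_unstable {c : Coeffs} {F : Family} (h : F.sign * c.C < 0) :
    familyStability c F = .unstable := by
  cases F <;> simp only [Family.sign] at h <;> simp only [familyStability]
  · rw [if_neg (by linarith)]
  · rw [if_pos (by linarith)]

/-- The slopes of the Hamiltonian on the axes decrease in `J` and the coupling has the sign of `C`:
then each family consists of at most one pair. -/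
structure SlopeDecreasing (c : Coeffs) (δ E : ℝ) : Prop where
  curv : ∀ F, ∀ J ∈ Icc 0 E, ∀ J' ∈ Icc 0 E, curvK c F δ E J J' < 0
  coup : ∀ J ∈ Icc 0 E, 0 < c.C * coupling c δ E J

namespace SlopeDecreasing

variable {c : Coeffs} {δ E : ℝ}

theorem lt (h : SlopeDecreasing c δ E) (F : Family) {J J' : ℝ} (hJ : J ∈ Icc 0 E)
    (hJ' : J' ∈ Icc 0 E) (hlt : J < J') : slopeK c F δ E J' < slopeK c F δ E J :=
  slopeK_lt hlt (h.curv F _ hJ' _ hJ)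

theorem sign_coup (h : SlopeDecreasing c δ E) (F : Family) {J : ℝ} (hJ : J ∈ Icc 0 E) :
    0 < (F.sign * c.C) * (F.sign * coupling c δ E J) := by
  have h1 := h.coup J hJ
  have h2 : F.sign * F.sign = 1 := by cases F <;> simp [Family.sign]
  calc 0 < c.C * coupling c δ E J := h1
    _ = (F.sign * F.sign) * (c.C * coupling c δ E J) := by rw [h2, one_mul]
    _ = _ := by ring

theorem familyPoints_eq_empty (h : SlopeDecreasing c δ E) {F : Family}
    (h0 : slopeK c F δ E 0 ≤ 0 ∨ 0 ≤ slopeK c F δ E E) : familyPoints c δ E F = ∅ := by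
  refine eq_empty_of_forall_notMem fun z hz => ?_
  obtain ⟨r, -, hr, hrE, hs⟩ := mem_familyPoints.1 hz
  have hr2 : 0 < r ^ 2 / 2 := by positivity
  have hE : 0 < E := hr2.trans hrE
  have h1 := h.lt F (left_mem_Icc.2 hE.le) ⟨hr2.le, hrE.le⟩ hr2
  have h2 := h.lt F ⟨hr2.le, hrE.le⟩ (right_mem_Icc.2 hE.le) hrE
  rcases h0 with h0 | h0 <;> linarith

theorem hasStability_axisPoint (h : SlopeDecreasing c δ E) {F : Family} {r : ℝ} (hr : r ≠ 0)
    (hrE : r ^ 2 / 2 < E) (hs : slopeK c F δ E (r ^ 2 / 2) = 0) :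
    HasStability (chartField c δ E .one) (F.axisPoint r) (familyStability c F) := by
  have hJ : r ^ 2 / 2 ∈ Icc 0 E := ⟨by positivity, hrE.le⟩
  have hcurv := h.curv F _ hJ _ hJ
  rcases pos_and_pos_or_neg_and_neg_of_mul_pos (h.sign_coup F hJ) with ⟨h1, h2⟩ | ⟨h1, h2⟩
  · rw [familyStability_eq_stable h1]
    exact lyapunovStable_axisPoint c δ E F hr hrE hs hcurv h2
  · rw [familyStability_eq_unstable h1]
    exact not_lyapunovStable_axisPoint c δ E F hr hrE hs hcurv h2

/-- The intermediate value theorem yields an action `J` where the slope vanishes, monotonicity makes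
it unique, and the pair sits at `±√(2J)` on the axis. -/
theorem isPair (h : SlopeDecreasing c δ E) {F : Family} (hE : 0 < E) (h0 : 0 < slopeK c F δ E 0)
    (h1 : slopeK c F δ E E < 0) :
    IsPair c δ E (familyStability c F) (familyPoints c δ E F) := by
  have hcont : ContinuousOn (fun J => slopeK c F δ E J) (Icc 0 E) :=
    ((continuous_slopeK c F δ).comp (by fun_prop : Continuous fun J : ℝ => (E, J))).continuousOn
  obtain ⟨J, hJ, hJ0⟩ := intermediate_value_Ioo' hE.le hcont ⟨h1, h0⟩
  simp only at hJ0
  set r := Real.sqrt (2 * J) with hr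
  have hr2 : r ^ 2 / 2 = J := by rw [hr, Real.sq_sqrt (by linarith [hJ.1])]; ring
  have hr0 : r ≠ 0 := (Real.sqrt_pos.2 (by linarith [hJ.1])).ne'
  refine ⟨⟨F.axisPoint r, fun h => ?_, ?_⟩, fun z hz => ?_⟩
  · have := F.sq_axisPoint r
    rw [h] at this
    simp at this
    exact hr0 (pow_eq_zero_iff two_ne_zero |>.1 this.symm)
  · ext z
    rw [mem_familyPoints, mem_insert_iff, mem_singleton_iff, Family.neg_axisPoint]
    constructor
    · rintro ⟨q, rfl, hq, hqE, hqs⟩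
      have hqJ : q ^ 2 / 2 = J := by
        have hqI : q ^ 2 / 2 ∈ Icc 0 E := ⟨by positivity, hqE.le⟩
        rcases lt_trichotomy (q ^ 2 / 2) J with hlt | heq | hlt
        · have := h.lt F hqI (Ioo_subset_Icc_self hJ) hlt; linarith
        · exact heq
        · have := h.lt F (Ioo_subset_Icc_self hJ) hqI hlt; linarith
      have : q ^ 2 = r ^ 2 := by linarith
      rcases sq_eq_sq_iff_eq_or_eq_neg.1 this with h' | h' <;> simp [h']
    · rintro (rfl | rfl)
      · exact ⟨r, rfl, hr0, by rw [hr2]; exact hJ.2, by rw [hr2]; exact hJ0⟩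
      · exact ⟨-r, rfl, neg_ne_zero.2 hr0, by rw [neg_sq, hr2]; exact hJ.2,
          by rw [neg_sq, hr2]; exact hJ0⟩
  · obtain ⟨q, rfl, hq, hqE, hqs⟩ := mem_familyPoints.1 hz
    exact h.hasStability_axisPoint hq hqE hqs

theorem fixedPoints_eq (h : SlopeDecreasing c δ E) :
    fixedPoints c δ E = familyPoints c δ E .inclined ∪ familyPoints c δ E .loop :=
  fixedPoints_eq_union fun J hJ h0 => by
    have := h.coup J (Ioo_subset_Icc_self hJ)
    rw [h0, mul_zero] at this
    exact this.false

end SlopeDecreasing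

/-! ### Pitchfork bifurcations -/

/-- Pairs are born from mode one and absorbed by mode two. -/
def Mode.direction : Mode → Direction
  | .one => .appears
  | .two => .disappears

/-- The sign of the slope of the Hamiltonian at the mode, on the axis of a family, at the energies
near the bifurcation at which the pair does not exist. -/
def Mode.sign : Mode → ℝ
  | .one => -1
  | .two => 1

/-- Because `m.sign ^ 2 = 1`, the product of the two slopes has the sign of `F.sign * c.C`, which
also decides the stability of the pair. -/
theorem modeHasStability_familyStability {c : Coeffs} {δ E : ℝ} {m : Mode} {F : Family}
    (h1 : 0 < m.sign * (F.sign * c.C) * slopeK c F.other δ E (m.action E))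
    (h2 : 0 < m.sign * slopeK c F δ E (m.action E)) :
    ModeHasStability c δ E m (familyStability c F) := by
  have h3 : 0 < (F.sign * c.C) *
      (slopeK c F δ E (m.action E) * slopeK c F.other δ E (m.action E)) := by
    have h4 : m.sign * m.sign = 1 := by cases m <;> simp [Mode.sign]
    have := mul_pos h1 h2
    linear_combination this + (F.sign * c.C) *
      (slopeK c F δ E (m.action E) * slopeK c F.other δ E (m.action E)) * h4
  rcases pos_and_pos_or_neg_and_neg_of_mul_pos h3 with ⟨h5, h6⟩ | ⟨h5, h6⟩
  · rw [familyStability_eq_stable h5]; exact lyapunovStable_mode c δ E m F h6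
  · rw [familyStability_eq_unstable h5]; exact not_lyapunovStable_mode c δ E m F h6

theorem modeHasStability_opposite {c : Coeffs} {δ E : ℝ} {m : Mode} {F : Family}
    (h1 : 0 < m.sign * (F.sign * c.C) * slopeK c F.other δ E (m.action E))
    (h2 : m.sign * slopeK c F δ E (m.action E) < 0) :
    ModeHasStability c δ E m (familyStability c F).opposite := by
  have h3 : (F.sign * c.C) *
      (slopeK c F δ E (m.action E) * slopeK c F.other δ E (m.action E)) < 0 := by
    have h4 : m.sign * m.sign = 1 := by cases m <;> simp [Mode.sign]
    have := mul_neg_of_pos_of_neg h1 h2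
    linear_combination this - (F.sign * c.C) *
      (slopeK c F δ E (m.action E) * slopeK c F.other δ E (m.action E)) * h4
  rcases mul_neg_iff.1 h3 with ⟨h5, h6⟩ | ⟨h5, h6⟩
  · rw [familyStability_eq_stable h5]; exact not_lyapunovStable_mode c δ E m F h6
  · rw [familyStability_eq_unstable h5]; exact lyapunovStable_mode c δ E m F h6

def Direction.emptyRay (Es : ℝ) : Direction → Set ℝ
  | .appears => Iio Es
  | .disappears => Ioi Es

def Direction.pairRay (Es : ℝ) : Direction → Set ℝ
  | .appears => Ioi Es
  | .disappears => Iio Es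

theorem mem_emptySide {Es r E : ℝ} {d : Direction} (h : E ∈ emptySide Es r d) :
    E ∈ d.emptyRay Es ∧ |E - Es| < r := by
  cases d <;> exact ⟨by first | exact h.1 | exact h.2,
    abs_lt.2 ⟨by linarith [h.1, h.2], by linarith [h.1, h.2]⟩⟩

theorem mem_pairSide {Es r E : ℝ} {d : Direction} (h : E ∈ pairSide Es r d) :
    E ∈ d.pairRay Es ∧ |E - Es| < r := by
  cases d <;> exact ⟨by first | exact h.1 | exact h.2,
    abs_lt.2 ⟨by linarith [h.1, h.2], by linarith [h.1, h.2]⟩⟩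

theorem modeDist_lt {c : Coeffs} {δ E : ℝ} {F : Family} (m : Mode) {z : ℝ × ℝ}
    (hz : z ∈ familyPoints c δ E F) : 0 < modeDist E m z ∧ modeDist E m z < E := by
  obtain ⟨h1, h2, -⟩ := hz.1
  cases m <;> simp only [modeDist] <;> constructor <;> linarith

theorem nearPoints_eq {c : Coeffs} {δ E : ℝ} {F : Family} (m : Mode) {ρ : ℝ} (h : E ≤ ρ) :
    nearPoints c δ E m F ρ = familyPoints c δ E F :=
  Subset.antisymm (fun _ hz => hz.1) fun _ hz => ⟨hz, (modeDist_lt m hz).2.trans_le h⟩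

theorem pitchfork_of_eventually {c : Coeffs} {δ Es : ℝ} {m : Mode} {F : Family} {σ : Stability}
    {d : Direction} (hEs : 0 < Es) (h0 : familyPoints c δ Es F = ∅)
    (he : ∀ᶠ E in 𝓝 Es, E ∈ d.emptyRay Es →
      familyPoints c δ E F = ∅ ∧ ModeHasStability c δ E m σ)
    (hp : ∀ᶠ E in 𝓝 Es, E ∈ d.pairRay Es →
      IsPair c δ E σ (familyPoints c δ E F) ∧ ModeHasStability c δ E m σ.opposite)
    (hlim : ∀ ε > 0, ∀ᶠ E in 𝓝 Es, E ∈ d.pairRay Es →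
      ∀ z ∈ familyPoints c δ E F, modeDist E m z < ε) :
    Pitchfork c δ Es m F σ d := by
  obtain ⟨r, hr, hball⟩ := Metric.eventually_nhds_iff.1 (he.and hp)
  -- `modeDist` is below `E < 2 * Es` on the family, so the radius `2 * Es` retains all of it.
  have hnear : ∀ E, |E - Es| < min r Es →
      nearPoints c δ E m F (2 * Es) = familyPoints c δ E F := fun E hE =>
    nearPoints_eq m (by linarith [(abs_lt.1 (hE.trans_le (min_le_right _ _))).2])
  refine ⟨hEs, min r Es, lt_min hr hEs, min_le_right _ _, 2 * Es, by linarith, ?_, ?_, ?_, ?_⟩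
  · rw [nearPoints_eq m (by linarith), h0]
  · intro E hE
    obtain ⟨h1, h2⟩ := mem_emptySide hE
    rw [hnear E h2]
    exact (hball (h2.trans_le (min_le_left _ _))).1 h1
  · intro E hE
    obtain ⟨h1, h2⟩ := mem_pairSide hE
    rw [hnear E h2]
    exact (hball (h2.trans_le (min_le_left _ _))).2 h1
  · intro ε hε
    obtain ⟨η, hη, hlt⟩ := Metric.eventually_nhds_iff.1 (hlim ε hε)
    refine ⟨η, hη, fun E hE hEη z hz => hlt hEη (mem_pairSide hE).1 z hz.1⟩

/-- A pitchfork bifurcation requires a critical point of the Hamiltonian on the axis of the family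
at the mode. -/
theorem slopeK_eq_zero_of_pitchfork {c : Coeffs} {δ Es : ℝ} {m : Mode} {F : Family}
    {σ : Stability} {d : Direction} (h : Pitchfork c δ Es m F σ d) :
    slopeK c F δ Es (m.action Es) = 0 := by
  obtain ⟨-, r, hr, -, ρ, -, -, -, hp, hlim⟩ := h
  by_contra hne
  obtain ⟨ε, hε, hball⟩ := Metric.eventually_nhds_iff.1
    ((continuous_slopeK c F δ).continuousAt (x := (Es, m.action Es)) |>.eventually_ne hne)
  obtain ⟨η, hη, hη'⟩ := hlim (ε / 2) (by linarith)
  obtain ⟨E, hE, hEη, hEε⟩ : ∃ E ∈ pairSide Es r d, |E - Es| < η ∧ |E - Es| < ε / 2 := by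
    -- At mode two, `J` differs from `Es` by at most `|E - Es|` plus the vanishing action; each gets
    -- `ε / 2`.
    set t := min (r / 2) (min (η / 2) (ε / 4)) with ht
    have ht0 : 0 < t := lt_min (by linarith) (lt_min (by linarith) (by linarith))
    have h1 : t ≤ r / 2 := min_le_left _ _
    have h2 : t ≤ η / 2 := (min_le_right _ _).trans (min_le_left _ _)
    have h3 : t ≤ ε / 4 := (min_le_right _ _).trans (min_le_right _ _)
    cases d
    · refine ⟨Es + t, ⟨by linarith, by linarith⟩, ?_⟩
      rw [add_sub_cancel_left, abs_of_pos ht0]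
      constructor <;> linarith
    · refine ⟨Es - t, ⟨by linarith, by linarith⟩, ?_⟩
      rw [sub_sub_cancel_left, abs_neg, abs_of_pos ht0]
      constructor <;> linarith
  obtain ⟨⟨⟨z, -, hz⟩, -⟩, -⟩ := hp E hE
  have hzn : z ∈ nearPoints c δ E m F ρ := hz ▸ mem_insert _ _
  have hd := hη' E hE hEη z hzn
  have hd0 := (modeDist_lt m hzn.1).1
  obtain ⟨q, rfl, -, hqE, hqs⟩ := mem_familyPoints.1 hzn.1
  refine hball (y := (E, q ^ 2 / 2)) ?_ hqs
  have hEs := abs_lt.1 hEε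
  rw [Prod.dist_eq, Real.dist_eq, Real.dist_eq, max_lt_iff, abs_lt (a := q ^ 2 / 2 - _)]
  refine ⟨by linarith, ?_⟩
  cases m <;> simp only [modeDist, Family.sq_axisPoint, Mode.action] at hd hd0 ⊢ <;>
    constructor <;> linarith [hEs.1, hEs.2]

/-! ### The critical energies -/

/-- The curves `e m F` of the zeros of the slopes at the modes, on a range of energies and
detunings where these determine the signs of the slopes. -/
structure Regime (c : Coeffs) (E₀ δ₀ : ℝ) (e : Mode → Family → ℝ → ℝ) : Prop where
  mono : ∀ δ ∈ Icc (-δ₀) 0, ∀ E ∈ Icc 0 E₀, SlopeDecreasing c δ E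
  nonneg : ∀ m F, threshold c m F < c.B → ∀ δ ∈ Icc (-δ₀) 0, 0 ≤ e m F δ
  pos : ∀ m F, threshold c m F < c.B → ∀ δ ∈ Ico (-δ₀) 0, 0 < e m F δ
  lt_top : ∀ m F, threshold c m F < c.B → ∀ δ ∈ Icc (-δ₀) 0, e m F δ < E₀
  root : ∀ m F, threshold c m F < c.B → ∀ δ ∈ Icc (-δ₀) 0,
    slopeK c F δ (e m F δ) (m.action (e m F δ)) = 0
  strictMono : ∀ m F, threshold c m F < c.B → ∀ δ ∈ Icc (-δ₀) 0,
    StrictMonoOn (fun E => slopeK c F δ E (m.action E)) (Icc 0 E₀)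
  below : ∀ m F, c.B < threshold c m F → ∀ δ ∈ Icc (-δ₀) 0, ∀ E ∈ Ioc 0 E₀,
    slopeK c F δ E (m.action E) < 0

namespace Regime

variable {c : Coeffs} {E₀ δ₀ : ℝ} {e : Mode → Family → ℝ → ℝ}

theorem pos_iff (R : Regime c E₀ δ₀ e) {m : Mode} {F : Family} (hB : threshold c m F < c.B)
    {δ : ℝ} (hδ : δ ∈ Icc (-δ₀) 0) {E : ℝ} (hE : E ∈ Icc 0 E₀) :
    0 < slopeK c F δ E (m.action E) ↔ e m F δ < E := by
  rw [← R.root m F hB δ hδ]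
  exact (R.strictMono m F hB δ hδ).lt_iff_lt
    ⟨R.nonneg m F hB δ hδ, (R.lt_top m F hB δ hδ).le⟩ hE

theorem neg_iff (R : Regime c E₀ δ₀ e) {m : Mode} {F : Family} (hB : threshold c m F < c.B)
    {δ : ℝ} (hδ : δ ∈ Icc (-δ₀) 0) {E : ℝ} (hE : E ∈ Icc 0 E₀) :
    slopeK c F δ E (m.action E) < 0 ↔ E < e m F δ := by
  rw [← R.root m F hB δ hδ]
  exact (R.strictMono m F hB δ hδ).lt_iff_lt hE
    ⟨R.nonneg m F hB δ hδ, (R.lt_top m F hB δ hδ).le⟩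

/-- At the critical energy of `F` the slope of the other family is still negative by
`slopeK_other_one`, so its zero comes later. -/
theorem lt_one_other (R : Regime c E₀ δ₀ e) {F : Family} (hF : 0 < F.sign * c.C)
    (hB : threshold c .one F < c.B) (hB' : threshold c .one F.other < c.B)
    {δ : ℝ} (hδ : δ ∈ Ico (-δ₀) 0) : e .one F δ < e .one F.other δ := by
  have hδ' := Ico_subset_Icc_self hδ
  have hpos := R.pos _ _ hB δ hδ
  have hE : e .one F δ ∈ Icc 0 E₀ := ⟨hpos.le, (R.lt_top _ _ hB δ hδ').le⟩
  rw [← R.neg_iff hB' hδ' hE]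
  have h1 := R.root _ _ hB δ hδ'
  simp only [Mode.action] at h1 ⊢
  rw [slopeK_other_one, h1]
  have h2 := pos_of_mul_pos_right ((R.mono δ hδ' _ hE).sign_coup F (left_mem_Icc.2 hE.1)) hF.le
  have := mul_pos hpos h2
  linarith

theorem lt_two_other (R : Regime c E₀ δ₀ e) {F : Family} (hF : F.sign * c.C < 0)
    (hB : threshold c .two F < c.B) (hB' : threshold c .two F.other < c.B)
    {δ : ℝ} (hδ : δ ∈ Ico (-δ₀) 0) : e .two F δ < e .two F.other δ := by
  have hδ' := Ico_subset_Icc_self hδ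
  have hpos := R.pos _ _ hB δ hδ
  have hE : e .two F δ ∈ Icc 0 E₀ := ⟨hpos.le, (R.lt_top _ _ hB δ hδ').le⟩
  rw [← R.neg_iff hB' hδ' hE]
  have h1 := R.root _ _ hB δ hδ'
  simp only [Mode.action] at h1 ⊢
  rw [slopeK_other_two, h1]
  have h2 := neg_of_mul_pos_right ((R.mono δ hδ' _ hE).sign_coup F (right_mem_Icc.2 hE.1)) hF.le
  have := mul_neg_of_pos_of_neg hpos h2
  linarith

/-- When the slope vanishes at mode one it is already negative at mode two, since it decreases in
`J`. -/
theorem one_lt_two (R : Regime c E₀ δ₀ e) {F : Family}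
    (hB : threshold c .one F < c.B) (hB' : threshold c .two F < c.B)
    {δ : ℝ} (hδ : δ ∈ Ico (-δ₀) 0) : e .one F δ < e .two F δ := by
  have hδ' := Ico_subset_Icc_self hδ
  have hpos := R.pos _ _ hB δ hδ
  have hE : e .one F δ ∈ Icc 0 E₀ := ⟨hpos.le, (R.lt_top _ _ hB δ hδ').le⟩
  rw [← R.neg_iff hB' hδ' hE, ← R.root _ _ hB δ hδ']
  exact (R.mono δ hδ' _ hE).lt F (left_mem_Icc.2 hE.1) (right_mem_Icc.2 hE.1) hpos

theorem pitchfork (R : Regime c E₀ δ₀ e) {m : Mode} {F : Family}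
    (hB : threshold c m F < c.B) {δ : ℝ} (hδ : δ ∈ Ico (-δ₀) 0) :
    Pitchfork c δ (e m F δ) m F (familyStability c F) m.direction := by
  have hδ' := Ico_subset_Icc_self hδ
  have hpos := R.pos _ _ hB δ hδ
  have htop := R.lt_top _ _ hB δ hδ'
  have hroot := R.root _ _ hB δ hδ'
  have hposiff : ∀ E ∈ Icc 0 E₀, (0 < slopeK c F δ E (m.action E) ↔ e m F δ < E) :=
    fun E hE => R.pos_iff hB hδ' hE
  have hnegiff : ∀ E ∈ Icc 0 E₀, (slopeK c F δ E (m.action E) < 0 ↔ E < e m F δ) :=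
    fun E hE => R.neg_iff hB hδ' hE
  generalize e m F δ = Es at *
  have hEs : Es ∈ Icc 0 E₀ := ⟨hpos.le, htop.le⟩
  have hM := R.mono δ hδ' Es hEs
  have hmem : ∀ᶠ E in 𝓝 Es, E ∈ Ioo 0 E₀ := Ioo_mem_nhds hpos htop
  have hc : ∀ G : Family, ∀ φ : ℝ → ℝ, Continuous φ → Continuous fun E => slopeK c G δ E (φ E) :=
    fun G φ hφ => (continuous_slopeK c G δ).comp (continuous_id.prodMk hφ)
  have hact : Continuous fun E => m.action E := by
    cases m
    exacts [continuous_const, continuous_id]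
  -- At `Es` the other slope is a multiple of the coupling; its sign persists nearby, so only the
  -- slope of `F` changes sign at the mode.
  have hother : ∀ᶠ E in 𝓝 Es,
      0 < m.sign * (F.sign * c.C) * slopeK c F.other δ E (m.action E) := by
    have hcont : Continuous fun E =>
        m.sign * (F.sign * c.C) * slopeK c F.other δ E (m.action E) :=
      continuous_const.mul (hc F.other _ hact)
    refine hcont.continuousAt.eventually_const_lt ?_
    cases m <;> simp only [Mode.action, Mode.sign] at hroot ⊢
    · rw [slopeK_other_one, hroot]
      have := mul_pos hpos (hM.sign_coup F (left_mem_Icc.2 hpos.le))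
      linarith
    · rw [slopeK_other_two, hroot]
      have := mul_pos hpos (hM.sign_coup F (right_mem_Icc.2 hpos.le))
      linarith
  cases m
  · simp only [Mode.action, Mode.direction, Mode.sign] at *
    have hfar : ∀ᶠ E in 𝓝 Es, slopeK c F δ E E < 0 := by
      refine (hc F _ continuous_id).continuousAt.eventually_lt_const ?_
      have := hM.lt F (left_mem_Icc.2 hpos.le) (right_mem_Icc.2 hpos.le) hpos
      simp only [id]; linarith
    refine pitchfork_of_eventually hpos (hM.familyPoints_eq_empty (.inl hroot.le)) ?_ ?_ ?_
    · filter_upwards [hmem, hother] with E hE ho hlt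
      have hE' := Ioo_subset_Icc_self hE
      have hs := (hnegiff E hE').2 hlt
      refine ⟨(R.mono δ hδ' E hE').familyPoints_eq_empty (.inl hs.le), ?_⟩
      exact modeHasStability_familyStability ho (by simp only [Mode.sign, Mode.action]; linarith)
    · filter_upwards [hmem, hother, hfar] with E hE ho hf hlt
      have hE' := Ioo_subset_Icc_self hE
      have hs := (hposiff E hE').2 hlt
      refine ⟨(R.mono δ hδ' E hE').isPair hE.1 hs hf, ?_⟩
      exact modeHasStability_opposite ho (by simp only [Mode.sign, Mode.action]; linarith)
    · intro ε hε
      set ε' := min ε Es with hε'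
      have hε0 : 0 < ε' := lt_min hε hpos
      -- At `Es` the slope falls from zero at `J = 0`, so it is negative at `J = ε'`, also for
      -- nearby `E`; the zero is then trapped below `ε'`.
      have hsl : ∀ᶠ E in 𝓝 Es, slopeK c F δ E ε' < 0 := by
        refine (hc F _ continuous_const).continuousAt.eventually_lt_const ?_
        have := hM.lt F (left_mem_Icc.2 hpos.le) ⟨hε0.le, min_le_right _ _⟩ hε0
        linarith
      filter_upwards [hmem, hsl] with E hE hs hlt z hz
      obtain ⟨q, rfl, -, hqE, hqs⟩ := mem_familyPoints.1 hz
      simp only [modeDist, Family.sq_axisPoint]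
      by_contra hcon
      have hle : ε' ≤ q ^ 2 / 2 := (min_le_left _ _).trans (not_lt.1 hcon)
      rcases hle.eq_or_lt with h | h
      · rw [h, hqs] at hs; exact hs.false
      · have := (R.mono δ hδ' E (Ioo_subset_Icc_self hE)).lt F
          ⟨hε0.le, h.le.trans hqE.le⟩ ⟨hε0.le.trans h.le, hqE.le⟩ h
        linarith
  · simp only [Mode.action, Mode.direction, Mode.sign] at *
    have hfar : ∀ᶠ E in 𝓝 Es, 0 < slopeK c F δ E 0 := by
      refine (hc F _ continuous_const).continuousAt.eventually_const_lt ?_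
      have := hM.lt F (left_mem_Icc.2 hpos.le) (right_mem_Icc.2 hpos.le) hpos
      linarith
    refine pitchfork_of_eventually hpos (hM.familyPoints_eq_empty (.inr hroot.ge)) ?_ ?_ ?_
    · filter_upwards [hmem, hother] with E hE ho hlt
      have hE' := Ioo_subset_Icc_self hE
      have hs := (hposiff E hE').2 hlt
      refine ⟨(R.mono δ hδ' E hE').familyPoints_eq_empty (.inr hs.le), ?_⟩
      exact modeHasStability_familyStability ho (by simp only [Mode.sign, Mode.action]; linarith)
    · filter_upwards [hmem, hother, hfar] with E hE ho hf hlt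
      have hE' := Ioo_subset_Icc_self hE
      have hs := (hnegiff E hE').2 hlt
      refine ⟨(R.mono δ hδ' E hE').isPair hE.1 hf hs, ?_⟩
      exact modeHasStability_opposite ho (by simp only [Mode.sign, Mode.action]; linarith)
    · intro ε hε
      -- With `E > Es / 2` this keeps `E - ε'` in the range of actions.
      set ε' := min ε (Es / 2) with hε'
      have hε0 : 0 < ε' := lt_min hε (by linarith)
      have hεE : ε' ≤ Es / 2 := min_le_right _ _
      have hsl : ∀ᶠ E in 𝓝 Es, 0 < slopeK c F δ E (E - ε') := by
        refine (hc F (fun E => E - ε')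
          (continuous_id.sub continuous_const)).continuousAt.eventually_const_lt ?_
        have := hM.lt F ⟨by linarith, by linarith⟩ (right_mem_Icc.2 hpos.le)
          (show Es - ε' < Es by linarith)
        linarith
      filter_upwards [hmem, hsl, lt_mem_nhds (show Es / 2 < Es by linarith)]
        with E hE hs hE2 hlt z hz
      obtain ⟨q, rfl, -, hqE, hqs⟩ := mem_familyPoints.1 hz
      simp only [modeDist, Family.sq_axisPoint]
      by_contra hcon
      have hle : q ^ 2 / 2 ≤ E - ε' := by linarith [min_le_left ε (Es / 2)]
      rcases hle.eq_or_lt with h | h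
      · rw [← h, hqs] at hs; exact hs.false
      · have := (R.mono δ hδ' E (Ioo_subset_Icc_self hE)).lt F
          ⟨by positivity, hqE.le⟩ ⟨by linarith, by linarith⟩ h
        linarith

theorem eq_of_pitchfork (R : Regime c E₀ δ₀ e) {m : Mode} {F : Family}
    (hB : c.B ≠ threshold c m F) {δ : ℝ} (hδ : δ ∈ Ico (-δ₀) 0) {E : ℝ} (hE : E ∈ Ioo 0 E₀)
    {σ : Stability} {d : Direction} (h : Pitchfork c δ E m F σ d) :
    threshold c m F < c.B ∧ E = e m F δ := by
  have hδ' := Ico_subset_Icc_self hδ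
  have h0 := slopeK_eq_zero_of_pitchfork h
  rcases hB.lt_or_gt with hlt | hlt
  · have := R.below m F hlt δ hδ' E ⟨hE.1, hE.2.le⟩
    linarith
  · refine ⟨hlt, (R.strictMono m F hlt δ hδ').injOn (Ioo_subset_Icc_self hE)
      ⟨R.nonneg m F hlt δ hδ', (R.lt_top m F hlt δ hδ').le⟩ ?_⟩
    simp only [h0, R.root m F hlt δ hδ']

/-- The signs of the slopes at the modes that make a pair, in terms of the critical energies. -/
theorem pair_iff (R : Regime c E₀ δ₀ e) {F : Family} (h1 : c.B ≠ threshold c .one F)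
    (h2 : c.B ≠ threshold c .two F) {δ : ℝ} (hδ : δ ∈ Icc (-δ₀) 0) {E : ℝ} (hE : E ∈ Ioo 0 E₀) :
    (threshold c .one F < c.B ∧ e .one F δ < E ∧ (threshold c .two F < c.B → E < e .two F δ)) ↔
      0 < slopeK c F δ E 0 ∧ slopeK c F δ E E < 0 := by
  have hE' := Ioo_subset_Icc_self hE
  have e1 : (threshold c .one F < c.B ∧ e .one F δ < E) ↔ 0 < slopeK c F δ E 0 := by
    rcases h1.lt_or_gt with h | h
    · have := R.below .one F h δ hδ E ⟨hE.1, hE.2.le⟩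
      exact iff_of_false (fun h' => h'.1.not_gt h) this.not_gt
    · rw [← R.pos_iff h hδ hE']; simp [h, Mode.action]
  have e2 : (threshold c .two F < c.B → E < e .two F δ) ↔ slopeK c F δ E E < 0 := by
    rcases h2.lt_or_gt with h | h
    · exact iff_of_true (fun h' => absurd h h'.not_gt) (R.below .two F h δ hδ E ⟨hE.1, hE.2.le⟩)
    · rw [← R.neg_iff h hδ hE']; simp [h, Mode.action]
  rw [← and_assoc, e1, e2]

end Regime

/-! ### Uniform range of parameters and expansion of the critical energies -/

theorem eventually_forall_mode_family {α : Type*} {l : Filter α} {P : Mode → Family → α → Prop}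
    (h : ∀ m F, ∀ᶠ x in l, P m F x) : ∀ᶠ x in l, ∀ m F, P m F x := by
  filter_upwards [h .one .inclined, h .one .loop, h .two .inclined, h .two .loop]
    with x h1 h2 h3 h4 m F
  cases m <;> cases F <;> assumption

theorem curvK_zero_neg {c : Coeffs} (hI : c.A - 3 * c.C < 0) (hL : c.A - c.C < 0) (F : Family) :
    curvK c F 0 0 0 0 < 0 := by
  cases F <;> simp only [curvK, quad, Family.sign] <;> linarith

/-- All the inequalities are strict at the origin and continuous. The last one lets `cE` dominate
the divided difference in `E` of the slope at a mode; `E' = 0` serves for the sign of the slope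
itself. -/
theorem exists_uniform_range (c : Coeffs) (hC : c.C ≠ 0) (hI : c.A - 3 * c.C < 0)
    (hL : c.A - c.C < 0) :
    ∃ ε > 0, ∀ δ ∈ Icc (-ε) 0, ∀ E ∈ Icc 0 ε, SlopeDecreasing c δ E ∧
      ∀ m F, cE c m F ≠ 0 → ∀ E' ∈ Icc 0 ε,
        |cδE c m F * δ + cEE c m F * (E + E')| < |cE c m F| / 2 := by
  have hcurv : ∀ F, ∀ᶠ q : ℝ × ℝ × ℝ × ℝ in 𝓝 0, curvK c F q.1 q.2.1 q.2.2.1 q.2.2.2 < 0 := by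
    intro F
    have hc : Continuous fun q : ℝ × ℝ × ℝ × ℝ => curvK c F q.1 q.2.1 q.2.2.1 q.2.2.2 := by
      unfold curvK quad; fun_prop
    exact hc.continuousAt.eventually_lt_const (curvK_zero_neg hI hL F)
  have hcoup : ∀ᶠ q : ℝ × ℝ × ℝ × ℝ in 𝓝 0, 0 < c.C * coupling c q.1 q.2.1 q.2.2.1 := by
    have hc : Continuous fun q : ℝ × ℝ × ℝ × ℝ => c.C * coupling c q.1 q.2.1 q.2.2.1 := by
      unfold coupling; fun_prop
    refine hc.continuousAt.eventually_const_lt ?_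
    have := mul_self_pos.2 hC
    simp only [coupling, Prod.fst_zero, Prod.snd_zero]; linarith
  -- The coordinate used for `J` elsewhere plays the role of `E'` here.
  have hslope : ∀ᶠ q : ℝ × ℝ × ℝ × ℝ in 𝓝 0, ∀ m F, cE c m F ≠ 0 →
      |cδE c m F * q.1 + cEE c m F * (q.2.1 + q.2.2.1)| < |cE c m F| / 2 := by
    refine eventually_forall_mode_family fun m F => ?_
    by_cases h0 : cE c m F = 0
    · exact .of_forall fun q h => absurd h0 h
    · have hc : Continuous fun q : ℝ × ℝ × ℝ × ℝ =>
          |cδE c m F * q.1 + cEE c m F * (q.2.1 + q.2.2.1)| := by fun_prop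
      refine (hc.continuousAt.eventually_lt_const ?_).mono fun q h _ => h
      simpa using h0
  obtain ⟨r, hr, hball⟩ := Metric.eventually_nhds_iff.1
    (((hcurv .inclined).and (hcurv .loop)).and (hcoup.and hslope))
  have hq : ∀ δ ∈ Icc (-(r / 2)) 0, ∀ E ∈ Icc 0 (r / 2), ∀ J ∈ Icc 0 (r / 2),
      ∀ J' ∈ Icc 0 (r / 2), dist ((δ, E, J, J') : ℝ × ℝ × ℝ × ℝ) 0 < r := by
    intro δ hδ E hE J hJ J' hJ'
    simp only [dist_zero_right, Prod.norm_def, Real.norm_eq_abs, max_lt_iff, abs_lt]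
    refine ⟨⟨?_, ?_⟩, ⟨?_, ?_⟩, ⟨?_, ?_⟩, ?_, ?_⟩ <;>
      linarith [hδ.1, hδ.2, hE.1, hE.2, hJ.1, hJ.2, hJ'.1, hJ'.2]
  refine ⟨r / 2, by linarith, fun δ hδ E hE => ⟨⟨fun F J hJ J' hJ' => ?_, fun J hJ => ?_⟩, ?_⟩⟩
  · have h := (hball (hq δ hδ E hE J ⟨hJ.1, hJ.2.trans hE.2⟩ J' ⟨hJ'.1, hJ'.2.trans hE.2⟩)).1
    cases F
    exacts [h.1, h.2]
  · have hJr : J ∈ Icc 0 (r / 2) := ⟨hJ.1, hJ.2.trans hE.2⟩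
    exact (hball (hq δ hδ E hE J hJr J hJr)).2.1
  · intro m F h0 E' hE'
    exact (hball (hq δ hδ E hE E' hE' E' hE')).2.2 m F h0

/-- The zero of `δ + α E + κ δ E + γ E ^ 2` that is small with `δ`. -/
theorem exists_small_root {α κ γ δ ε : ℝ} (hε : 0 < ε) (hδ : δ ≤ 0)
    (hδε : 2 * |δ| < α * ε) (h : |κ * δ + γ * (ε + 0)| < α / 2) :
    ∃ E, 0 ≤ E ∧ E < ε ∧ (δ < 0 → 0 < E) ∧ δ + α * E + κ * δ * E + γ * E ^ 2 = 0 := by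
  have hc : ContinuousOn (fun E => δ + α * E + κ * δ * E + γ * E ^ 2) (Icc 0 ε) := by fun_prop
  have h1 := (abs_lt.1 h).1
  -- At `E = ε` the corrections cost less than `α * ε / 2`, and `|δ|` is smaller than what remains.
  have hend : 0 < δ + α * ε + κ * δ * ε + γ * ε ^ 2 := by
    have h2 : 0 < (κ * δ + γ * (ε + 0) + α / 2) * ε := mul_pos (by linarith) hε
    rw [abs_of_nonpos hδ] at hδε
    nlinarith
  obtain ⟨E, hE, hE0⟩ := intermediate_value_Icc hε.le hc
    (show (0 : ℝ) ∈ Icc _ _ from ⟨by simpa using hδ, hend.le⟩)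
  simp only at hE0
  refine ⟨E, hE.1, hE.2.lt_of_ne ?_, fun hlt => hE.1.lt_of_ne ?_, hE0⟩
  · rintro rfl; linarith
  · rintro rfl; simp at hE0; linarith

/-- The expansion of the small zero of `δ + α E + κ δ E + γ E ^ 2` to second order in `δ`. -/
theorem abs_root_sub_le {α κ γ δ E : ℝ} (hα : 0 < α) (hE : 0 ≤ E) (hδ : δ ≤ 0)
    (h : |κ * δ + γ * (E + 0)| < α / 2) (h0 : δ + α * E + κ * δ * E + γ * E ^ 2 = 0) :
    |E - (-δ / α + (κ * α - γ) * δ ^ 2 / α ^ 3)| ≤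
      (2 / α * (|κ| + |γ| * (2 / α))) * (|κ| + |γ| * (3 / α)) / α ^ 2 * |δ| ^ 3 := by
  -- The corrections absorb at most half of `α * E`, so `α * E / 2 ≤ -δ`.
  have hE2 : E ≤ 2 / α * |δ| := by
    have h1 := mul_nonneg hE (by linarith [(abs_lt.1 h).1] : 0 ≤ κ * δ + γ * (E + 0) + α / 2)
    rw [abs_of_nonpos hδ, div_mul_eq_mul_div, le_div_iff₀ hα]
    nlinarith
  have hd := abs_nonneg δ
  have hu : |α * E + δ| ≤ 2 / α * (|κ| + |γ| * (2 / α)) * |δ| ^ 2 := by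
    have e1 : α * E + δ = -(E * (κ * δ + γ * E)) := by linear_combination h0
    rw [e1, abs_neg, abs_mul, abs_of_nonneg hE]
    have e2 : |κ * δ + γ * E| ≤ (|κ| + |γ| * (2 / α)) * |δ| := by
      calc |κ * δ + γ * E| ≤ |κ * δ| + |γ * E| := abs_add_le _ _
        _ = |κ| * |δ| + |γ| * E := by rw [abs_mul, abs_mul, abs_of_nonneg hE]
        _ ≤ |κ| * |δ| + |γ| * (2 / α * |δ|) := by gcongr
        _ = _ := by ring
    calc E * |κ * δ + γ * E| ≤ (2 / α * |δ|) * ((|κ| + |γ| * (2 / α)) * |δ|) := by gcongr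
      _ = _ := by ring
  have hv : |κ * δ + γ * (E - δ / α)| ≤ (|κ| + |γ| * (3 / α)) * |δ| := by
    have e1 : |E - δ / α| ≤ 3 / α * |δ| := by
      calc |E - δ / α| ≤ |E| + |δ / α| := abs_sub _ _
        _ = E + |δ| / α := by rw [abs_div, abs_of_nonneg hE, abs_of_pos hα]
        _ ≤ 2 / α * |δ| + |δ| / α := by gcongr
        _ = _ := by ring
    calc |κ * δ + γ * (E - δ / α)| ≤ |κ * δ| + |γ * (E - δ / α)| := abs_add_le _ _
      _ = |κ| * |δ| + |γ| * |E - δ / α| := by rw [abs_mul, abs_mul]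
      _ ≤ |κ| * |δ| + |γ| * (3 / α * |δ|) := by gcongr
      _ = _ := by ring
  -- The error is a product of `α * E + δ = O(δ²)` and a factor `O(δ)`, hence of third order.
  have key : E - (-δ / α + (κ * α - γ) * δ ^ 2 / α ^ 3) =
      -((α * E + δ) * (κ * δ + γ * (E - δ / α))) / α ^ 2 := by
    field_simp
    linear_combination α ^ 2 * h0
  rw [key, abs_div, abs_neg, abs_mul, abs_of_pos (by positivity : 0 < α ^ 2)]
  calc |α * E + δ| * |κ * δ + γ * (E - δ / α)| / α ^ 2
      ≤ (2 / α * (|κ| + |γ| * (2 / α)) * |δ| ^ 2) * ((|κ| + |γ| * (3 / α)) * |δ|) / α ^ 2 := by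
        gcongr
    _ = _ := by ring

theorem exists_regime (c : Coeffs) (hC : c.C ≠ 0) (hI : c.A - 3 * c.C < 0)
    (hL : c.A - c.C < 0) :
    ∃ E₀ > 0, ∃ δ₀ > 0, ∃ M : ℝ, ∃ e : Mode → Family → ℝ → ℝ, Regime c E₀ δ₀ e ∧
      ∀ m F, threshold c m F < c.B → ∀ δ ∈ Icc (-δ₀) 0,
        |e m F δ - criticalEnergy c δ m F| ≤ M * |δ| ^ 3 := by
  obtain ⟨ε, hε, hrange⟩ := exists_uniform_range c hC hI hL
  obtain ⟨δ₀, ⟨hδ₀, hδ₀ε⟩, hδ₀s⟩ : ∃ δ₀ : ℝ, (0 < δ₀ ∧ δ₀ < ε) ∧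
      ∀ m F, cE c m F ≠ 0 → 2 * δ₀ < |cE c m F| * ε := by
    refine (Eventually.and (Ioo_mem_nhdsGT hε)
      (eventually_forall_mode_family (l := 𝓝[>] (0 : ℝ)) fun m F => ?_)).exists
    by_cases h0 : cE c m F = 0
    · exact .of_forall fun q h => absurd h0 h
    · have h1 : 0 < |cE c m F| * ε / 2 := by positivity
      filter_upwards [Ioo_mem_nhdsGT h1] with x hx _
      linarith [hx.2]
  have hsub : Icc (-δ₀) 0 ⊆ Icc (-ε) 0 := Icc_subset_Icc_left (by linarith)
  have hpos : ∀ m F, threshold c m F < c.B → 0 < cE c m F := fun m F h => by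
    unfold cE; linarith
  have hroot : ∀ m F δ, threshold c m F < c.B → δ ∈ Icc (-δ₀) 0 → ∃ E, 0 ≤ E ∧ E < ε ∧
      (δ < 0 → 0 < E) ∧ δ + cE c m F * E + cδE c m F * δ * E + cEE c m F * E ^ 2 = 0 := by
    intro m F δ hB hδ
    have hα := hpos m F hB
    have h1 := (hrange δ (hsub hδ) ε (right_mem_Icc.2 hε.le)).2 m F hα.ne' 0
      (left_mem_Icc.2 hε.le)
    have h2 := hδ₀s m F hα.ne'
    rw [abs_of_pos hα] at h1 h2
    refine exists_small_root hε hδ.2 (lt_of_le_of_lt ?_ h2) h1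
    rw [abs_of_nonpos hδ.2]; linarith [hδ.1]
  -- Where the condition on `B` fails, the value of `e` is arbitrary.
  choose! e he0 heε hepos he using hroot
  set M : Mode → Family → ℝ := fun m F => (2 / cE c m F * (|cδE c m F| + |cEE c m F| *
    (2 / cE c m F))) * (|cδE c m F| + |cEE c m F| * (3 / cE c m F)) / cE c m F ^ 2 with hM
  set M₀ := |M .one .inclined| + |M .one .loop| + |M .two .inclined| + |M .two .loop| with hM₀
  have hMle : ∀ m F, M m F ≤ M₀ := fun m F => by
    have h1 := abs_nonneg (M .one .inclined)
    have h2 := abs_nonneg (M .one .loop)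
    have h3 := abs_nonneg (M .two .inclined)
    have h4 := abs_nonneg (M .two .loop)
    have h5 := le_abs_self (M m F)
    cases m <;> cases F <;> linarith
  refine ⟨ε, hε, δ₀, hδ₀, M₀, e, ⟨fun δ hδ E hE => (hrange δ (hsub hδ) E hE).1, ?_, ?_, ?_, ?_,
    ?_, ?_⟩, ?_⟩
  · exact fun m F hB δ hδ => he0 m F δ hB hδ
  · exact fun m F hB δ hδ => hepos m F δ hB (Ico_subset_Icc_self hδ) hδ.2
  · exact fun m F hB δ hδ => heε m F δ hB hδ
  · intro m F hB δ hδ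
    rw [slopeK_mode]
    exact he m F δ hB hδ
  · intro m F hB δ hδ E hE E' hE' hlt
    have hα := hpos m F hB
    have h1 := (hrange δ (hsub hδ) E hE).2 m F hα.ne' E' hE'
    rw [abs_of_pos hα] at h1
    simp only [slopeK_mode]
    have h2 : 0 < (E' - E) * (cE c m F + (cδE c m F * δ + cEE c m F * (E + E'))) :=
      mul_pos (by linarith) (by linarith [(abs_lt.1 h1).1])
    linarith
  · intro m F hB δ hδ E hE
    have hα : cE c m F < 0 := by unfold cE; linarith
    have h1 := (hrange δ (hsub hδ) E (Ioc_subset_Icc_self hE)).2 m F hα.ne 0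
      (left_mem_Icc.2 hε.le)
    rw [abs_of_neg hα] at h1
    rw [slopeK_mode]
    have h2 : E * (cE c m F + (cδE c m F * δ + cEE c m F * (E + 0))) < 0 :=
      mul_neg_of_pos_of_neg hE.1 (by linarith [(abs_lt.1 h1).2])
    linarith [hδ.2]
  · intro m F hB δ hδ
    have hα := hpos m F hB
    have h1 := (hrange δ (hsub hδ) (e m F δ) ⟨he0 m F δ hB hδ, (heε m F δ hB hδ).le⟩).2 m F
      hα.ne' 0 (left_mem_Icc.2 hε.le)
    rw [abs_of_pos hα] at h1
    rw [criticalEnergy_eq c m F hα.ne']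
    refine (abs_root_sub_le hα (he0 m F δ hB hδ) hδ.2 h1 (he m F δ hB hδ)).trans ?_
    exact mul_le_mul_of_nonneg_right (hMle m F) (by positivity)

/-- When the condition of the bifurcation fails, the slope at the mode has no zero at energies
comparable to the detuning. -/
theorem slopeK_neg_of_le_threshold {c : Coeffs} {m : Mode} {F : Family}
    (hB : c.B ≤ threshold c m F) (L : ℝ) :
    ∃ δ₁ > 0, ∀ δ ∈ Ico (-δ₁) 0, ∀ E ∈ Ioc 0 (L * |δ|), slopeK c F δ E (m.action E) < 0 := by
  set K := |cδE c m F| * |L| + |cEE c m F| * |L| ^ 2 with hK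
  have hK0 : 0 ≤ K := by positivity
  -- For `E ≤ L * |δ|` the quadratic corrections are at most `K * δ²`, and `K * |δ| < 1` lets `δ <
  -- 0` win, even when `cE = 0`.
  refine ⟨1 / (K + 1), by positivity, fun δ hδ E hE => ?_⟩
  have hd : |δ| = -δ := abs_of_neg hδ.2
  have hδ0 : 0 < |δ| := abs_pos.2 hδ.2.ne
  have hEL : E ≤ |L| * |δ| :=
    hE.2.trans (mul_le_mul_of_nonneg_right (le_abs_self L) (abs_nonneg δ))
  have h1 : cE c m F * E ≤ 0 := mul_nonpos_of_nonpos_of_nonneg (by unfold cE; linarith) hE.1.le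
  have h2 : cδE c m F * δ * E ≤ |cδE c m F| * |δ| * (|L| * |δ|) := by
    refine (le_abs_self _).trans ?_
    rw [abs_mul, abs_mul, abs_of_pos hE.1]
    gcongr
  have h3 : cEE c m F * E ^ 2 ≤ |cEE c m F| * (|L| * |δ|) ^ 2 := by
    have := hE.1.le
    refine (mul_le_mul_of_nonneg_right (le_abs_self _) (sq_nonneg E)).trans ?_
    gcongr
  have h4 : |δ| * K < 1 := by
    have h5 : |δ| ≤ 1 / (K + 1) := by rw [hd]; linarith [hδ.1]
    rw [le_div_iff₀ (by positivity)] at h5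
    linarith
  have h6 := mul_lt_mul_of_pos_left h4 hδ0
  rw [slopeK_mode]
  have h7 : |cδE c m F| * |δ| * (|L| * |δ|) + |cEE c m F| * (|L| * |δ|) ^ 2 = |δ| * (|δ| * K) := by
    rw [hK]; ring
  linarith

end Resonance22

end

/-! ### The bifurcation sequences -/

open Resonance22 in
theorem proposition5 (c : Coeffs) (hC : c.C ≠ 0) (hI : c.A - 3 * c.C < 0)
    (hL : c.A - c.C < 0) :
    ∃ E₀ > 0, ∃ δ₀ > 0, ∃ M : ℝ, ∃ e : Mode → Family → ℝ → ℝ,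
      -- the bifurcation curves, up to terms of third order in the detuning
      (∀ m F, threshold c m F < c.B → ∀ δ ∈ Icc (-δ₀) 0,
        |e m F δ - criticalEnergy c δ m F| ≤ M * |δ| ^ 3) ∧
      (∀ m F, threshold c m F < c.B → ∀ δ ∈ Ico (-δ₀) 0, 0 < e m F δ ∧ e m F δ < E₀) ∧
      -- the sequence (1I) - (1ℓ) - (2ℓ) - (2I)
      (0 < c.C → ∀ δ ∈ Ico (-δ₀) 0,
        (2 * (c.A - 3 * c.C) < c.B →
          Pitchfork c δ (e .one .inclined δ) .one .inclined .stable .appears) ∧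
        (2 * (c.A - c.C) < c.B →
          e .one .inclined δ < e .one .loop δ ∧
          Pitchfork c δ (e .one .loop δ) .one .loop .unstable .appears) ∧
        (2 * (c.C - c.A) < c.B →
          e .one .loop δ < e .two .loop δ ∧
          Pitchfork c δ (e .two .loop δ) .two .loop .unstable .disappears) ∧
        (2 * (3 * c.C - c.A) < c.B →
          e .two .loop δ < e .two .inclined δ ∧
          Pitchfork c δ (e .two .inclined δ) .two .inclined .stable .disappears)) ∧
      -- the sequence (1L) - (1i) - (2i) - (2L)
      (c.C < 0 → ∀ δ ∈ Ico (-δ₀) 0,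
        (2 * (c.A - c.C) < c.B →
          Pitchfork c δ (e .one .loop δ) .one .loop .stable .appears) ∧
        (2 * (c.A - 3 * c.C) < c.B →
          e .one .loop δ < e .one .inclined δ ∧
          Pitchfork c δ (e .one .inclined δ) .one .inclined .unstable .appears) ∧
        (2 * (3 * c.C - c.A) < c.B →
          e .one .inclined δ < e .two .inclined δ ∧
          Pitchfork c δ (e .two .inclined δ) .two .inclined .unstable .disappears) ∧
        (2 * (c.C - c.A) < c.B →
          e .two .inclined δ < e .two .loop δ ∧
          Pitchfork c δ (e .two .loop δ) .two .loop .stable .disappears)) ∧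
      -- a bifurcation occurs at low energy only under its condition, and only on its curve
      (∀ m F, c.B ≠ threshold c m F → ∀ δ ∈ Ico (-δ₀) 0, ∀ E ∈ Ioo 0 E₀, ∀ σ d,
        Pitchfork c δ E m F σ d → threshold c m F < c.B ∧ E = e m F δ) ∧
      (∀ m F, c.B ≤ threshold c m F → ∀ L : ℝ, ∃ δ₁ > 0, ∀ δ ∈ Ico (-δ₁) 0,
        ∀ E ∈ Ioc 0 (L * |δ|), ∀ σ d, ¬ Pitchfork c δ E m F σ d) ∧
      -- the fixed points between the bifurcations, for all non-positive detunings
      (∀ δ ∈ Icc (-δ₀) 0, ∀ E ∈ Ioo 0 E₀,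
        fixedPoints c δ E = familyPoints c δ E .inclined ∪ familyPoints c δ E .loop ∧
        ∀ F, c.B ≠ threshold c .one F → c.B ≠ threshold c .two F →
          ((threshold c .one F < c.B ∧ e .one F δ < E ∧
              (threshold c .two F < c.B → E < e .two F δ)) →
            IsPair c δ E (familyStability c F) (familyPoints c δ E F)) ∧
          (¬ (threshold c .one F < c.B ∧ e .one F δ < E ∧
              (threshold c .two F < c.B → E < e .two F δ)) →
            familyPoints c δ E F = ∅)) := by

  obtain ⟨E₀, hE₀, δ₀, hδ₀, M, e, R, hM⟩ := exists_regime c hC hI hL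
  refine ⟨E₀, hE₀, δ₀, hδ₀, M, e, hM,
    fun m F hB δ hδ => ⟨R.pos m F hB δ hδ, R.lt_top m F hB δ (Ico_subset_Icc_self hδ)⟩,
    ?_, ?_, ?_, ?_, ?_⟩
  · intro hC δ hδ
    have sI : familyStability c .inclined = .stable := if_pos hC
    have sL : familyStability c .loop = .unstable := if_pos hC
    have hsI : 0 < Family.inclined.sign * c.C := by simpa [Family.sign] using hC
    have hsL : Family.loop.sign * c.C < 0 := by simpa [Family.sign] using hC
    -- For `C > 0`, `2(A - 3C) < 2(A - C) < 0 < 2(C - A) < 2(3C - A)`: each condition on `B` implies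
    -- the earlier ones, so comparing neighbours suffices.
    refine ⟨fun h => ?_, fun h => ⟨?_, ?_⟩, fun h => ⟨?_, ?_⟩, fun h => ⟨?_, ?_⟩⟩
    · exact sI ▸ R.pitchfork (m := .one) (F := .inclined) h hδ
    · exact R.lt_one_other hsI (show 2 * (c.A - 3 * c.C) < c.B by linarith) h hδ
    · exact sL ▸ R.pitchfork (m := .one) (F := .loop) h hδ
    · exact R.one_lt_two (F := .loop) (show 2 * (c.A - c.C) < c.B by linarith) h hδ
    · exact sL ▸ R.pitchfork (m := .two) (F := .loop) h hδ
    · exact R.lt_two_other hsL (show 2 * (c.C - c.A) < c.B by linarith) h hδ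
    · exact sI ▸ R.pitchfork (m := .two) (F := .inclined) h hδ
  · intro hC δ hδ
    have sI : familyStability c .inclined = .unstable := if_neg hC.not_gt
    have sL : familyStability c .loop = .stable := if_neg hC.not_gt
    have hsI : Family.inclined.sign * c.C < 0 := by simpa [Family.sign] using hC
    have hsL : 0 < Family.loop.sign * c.C := by simpa [Family.sign] using hC
    -- For `C < 0` the chain is `2(A - C) < 2(A - 3C) < 0 < 2(3C - A) < 2(C - A)`.
    refine ⟨fun h => ?_, fun h => ⟨?_, ?_⟩, fun h => ⟨?_, ?_⟩, fun h => ⟨?_, ?_⟩⟩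
    · exact sL ▸ R.pitchfork (m := .one) (F := .loop) h hδ
    · exact R.lt_one_other hsL (show 2 * (c.A - c.C) < c.B by linarith) h hδ
    · exact sI ▸ R.pitchfork (m := .one) (F := .inclined) h hδ
    · exact R.one_lt_two (F := .inclined) (show 2 * (c.A - 3 * c.C) < c.B by linarith) h hδ
    · exact sI ▸ R.pitchfork (m := .two) (F := .inclined) h hδ
    · exact R.lt_two_other hsI (show 2 * (3 * c.C - c.A) < c.B by linarith) h hδ
    · exact sL ▸ R.pitchfork (m := .two) (F := .loop) h hδ
  · intro m F hB δ hδ E hE σ d h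
    exact R.eq_of_pitchfork hB hδ hE h
  · intro m F hB L
    obtain ⟨δ₁, hδ₁, hneg⟩ := slopeK_neg_of_le_threshold hB L
    exact ⟨δ₁, hδ₁, fun δ hδ E hE σ d h =>
      (hneg δ hδ E hE).ne (slopeK_eq_zero_of_pitchfork h)⟩
  · intro δ hδ E hE
    have hmono := R.mono δ hδ E (Ioo_subset_Icc_self hE)
    refine ⟨hmono.fixedPoints_eq, fun F h1 h2 => ?_⟩
    rw [R.pair_iff h1 h2 hδ hE]
    refine ⟨fun h => hmono.isPair hE.1 h.1 h.2, fun h => hmono.familyPoints_eq_empty ?_⟩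
    by_contra! hcon
    exact h hcon
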